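/- **Notation.** For a category $C$ with small Hom-sets, $\mathrm{Ind}(C)$ is the category of ind-objects of $C$ (small filtered systems $(X_\alpha)$ in $C$, with $\mathrm{Hom}((X_\alpha),(Y_\beta))=\varprojlim_\alpha\varinjlim_\beta \mathrm{Hom}_C(X_\alpha,Y_\beta)$; equivalently, the full subcategory of presheaves of sets on $C$ consisting of small filtered colimits of representables), and $\mathrm{Pro}(C)=\mathrm{Ind}(C^{op})^{op}$. A functor $F:C\to D$ extends to $\mathrm{Ind}(F):\mathrm{Ind}(C)\to\mathrm{Ind}(D)$, $(X_\alpha)\mapsto (F(X_\alpha))$, and similarly to $\mathrm{Pro}(F)$. For an abelian category $B$, $C^b(B)$ is the category of bounded cochain complexes in $B$, $D^b(B)$ is the bounded derived category, and $Q:C^b(B)\to D^b(B)$ is the canonical functor. Let $A$ be an abelian category with small Hom-sets, whose derived category has small Hom-sets (automatic if $A$ is essentially small). Then $\mathrm{Ind}(A)$ and $\mathrm{Pro}(A)$ are abelian. Let $\mathrm{ind}(D^b(A))$ be the full subcategory of $\mathrm{Ind}(D^b(A))$ of the objects that can be given by a small filtered system $(X_\alpha)$ in $D^b(A)$ for which there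 is $N\in\mathbb N$ with $H^i(X_\alpha)=0$ for all $\alpha$ and all $i\notin[-N,N]$; the full subcategory $\mathrm{pro}(D^b(A))$ of $\mathrm{Pro}(D^b(A))$ is defined dually, by cofiltered systems. Let $J:C^b(\mathrm{Ind}(A))\to \mathrm{Ind}(C^b(A))$ be the functor that rewrites a bounded complex of ind-objects as a filtered system of bounded complexes, that is, the ind-adjoint of the canonical functor $C^b(A)\to C^b(\mathrm{Ind}(A))$, determined by $$\mathrm{Hom}_{\mathrm{Ind}(C^b(A))}(X,JZ)=\mathrm{Hom}_{C^b(\mathrm{Ind}(A))}(X,Z)\qquad (X\in C^b(A),\ Z\in C^b(\mathrm{Ind}(A))).$$ Dually, let $J:C^b(\mathrm{Pro}(A))\to\mathrm{Pro}(C^b(A))$ be the pro-adjoint of $C^b(A)\to C^b(\mathrm{Pro}(A))$, determined by $\mathrm{Hom}_{\mathrm{Pro}(C^b(A))}(JZ,X)=\mathrm{Hom}_{C^b(\mathrm{Pro}(A))}(Z,X)$. **Proposition.** 1. There is a functor $\bar J:D^b(\mathrm{Ind}(A))\to \mathrm{ind}(D^b(A))$ induced by $J$, that is, such that the two composites $\bar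 J\circ Q$ and $\mathrm{Ind}(Q)\circ J$ from $C^b(\mathrm{Ind}(A))$ to $\mathrm{Ind}(D^b(A))$ are isomorphic; and every such functor $\bar J$ is conservative: a morphism $\varphi$ of $D^b(\mathrm{Ind}(A))$ is an isomorphism whenever $\bar J(\varphi)$ is one. 2. Dually, there is a functor $\bar J:D^b(\mathrm{Pro}(A))\to \mathrm{pro}(D^b(A))$ such that $\bar J\circ Q$ and $\mathrm{Pro}(Q)\circ J$ are isomorphic as functors from $C^b(\mathrm{Pro}(A))$ to $\mathrm{Pro}(D^b(A))$; and every such functor $\bar J$ is conservative. -/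

import Mathlib

open CategoryTheory Limits Opposite

universe w w₁ w₂ v u₁ u₂ u

/-!
Ind- and pro-objects of a category `C` are taken with values in the universe `v` of its morphisms;
`C` itself is not assumed to be small. `Ind C` is Mathlib's category of ind-objects (presheaves
that are small filtered colimits of representable ones).
-/

namespace IndPro

/-! ### The category of ind-objects of an abelian category is abelian

Mathlib has this for small categories; the arguments below remove the smallness. -/

section
variable (C : Type u) [Category.{v} C]

lemma preservesFiniteLimits_of_isIndObject {P : Cᵒᵖ ⥤ Type v} (h : IsIndObject P) :
    PreservesFiniteLimits P := by
  have p := h.presentation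
  exact ObjectProperty.prop_of_isColimit (P := ObjectProperty.preservesFiniteLimits)
    p.isColimit (fun i => (inferInstance : PreservesFiniteLimits (yoneda.obj (p.F.obj i))))

/-- Ind-objects are left exact presheaves. -/
noncomputable def indToLex : Ind C ⥤ (Cᵒᵖ ⥤ₗ Type v) :=
  ObjectProperty.lift _ (Ind.inclusion C) (fun X => (leftExactFunctor_iff _).2
    (preservesFiniteLimits_of_isIndObject C X.isIndObject_inclusion_obj))

/-- The functor `indToLex` is fully faithful. -/
noncomputable def indToLexFullyFaithful : (indToLex C).FullyFaithful :=
  Functor.FullyFaithful.ofCompFaithful (G := ObjectProperty.ι _)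
    (Ind.inclusion.fullyFaithful (C := C))

noncomputable instance indPreadditive [Abelian C] : Preadditive (Ind C) :=
  letI : HasFiniteBiproducts Cᵒᵖ := Abelian.hasFiniteBiproducts
  .ofFullyFaithful (((indToLexFullyFaithful C).comp
    (AddCommGrpCat.leftExactFunctorForgetEquivalence Cᵒᵖ).fullyFaithfulInverse).comp
      (ObjectProperty.fullyFaithfulι _))

instance [Abelian C] : HasFiniteBiproducts (Ind C) :=
  HasFiniteBiproducts.of_hasFiniteCoproducts

end

section

open CategoryTheory.Abelian

variable {C : Type u} [Category.{v} C]

instance [Abelian C] {X Y : Ind C} (f : X ⟶ Y) : IsIso (Abelian.coimageImageComparison f) := by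
  obtain ⟨I, _, _, F, G, ϕ, ⟨i⟩⟩ := Ind.exists_nonempty_arrow_mk_iso_ind_lim (f := f)
  let i' : Arrow.mk (coimageImageComparison f) ≅
      Arrow.mk (coimageImageComparison ((Ind.lim I).map ϕ)) :=
    coimageImageComparisonFunctor.mapIso i
  have := Iso.isIso_hom i'
  have e : IsIso (coimageImageComparison f) ↔ IsIso (coimageImageComparison ((Ind.lim I).map ϕ)) :=
    Arrow.isIso_iff_isIso_of_isIso i'.hom
  rw [e,
    Arrow.isIso_iff_isIso_of_isIso (PreservesCoimageImageComparison.iso (Ind.lim I) ϕ).inv]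
  infer_instance

noncomputable instance indAbelian [Abelian C] : Abelian (Ind C) :=
  .ofCoimageImageComparisonIsIso

end

/-! ### Extension of functors to ind-objects -/

section
variable {C : Type u₁} [Category.{v} C] {D : Type u₂} [Category.{v} D]

instance (X : Ind C) : HasColimitsOfShape (CostructuredArrow Ind.yoneda X) (Ind D) := by
  let e :=  ((CostructuredArrow.post Ind.yoneda (Ind.inclusion C) X).asEquivalence.trans
      (CostructuredArrow.mapNatIso Ind.yonedaCompInclusion))
  let G : X.presentation.I ⥤ CostructuredArrow Ind.yoneda X :=
    X.presentation.toCostructuredArrow ⋙ e.inverse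
  exact Functor.Final.hasColimitsOfShape_of_final G

/-- The functor `Ind(F) : Ind(C) ⥤ Ind(D)` that extends `F : C ⥤ D` by the formula
`Ind(F)("colim" Xᵢ) = "colim" F(Xᵢ)`. It is the (pointwise) left Kan extension of
`C ⥤ D ⥤ Ind(D)` along `C ⥤ Ind(C)`: its value at `P` is the colimit in `Ind(D)`, over the
filtered category of all `X` in `C` with a morphism `X ⟶ P`, of the objects `F(X)`. -/
noncomputable def indMap (F : C ⥤ D) : Ind C ⥤ Ind D :=
  Ind.yoneda.leftKanExtension (F ⋙ Ind.yoneda)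

/-! ### Criteria for presheaves to be ind-objects -/

lemma isIndObject_comp_of_isRepresentable (F : C ⥤ D)
    (hF : ∀ d : D, (F.op ⋙ yoneda.obj d).IsRepresentable) {W : Dᵒᵖ ⥤ Type v}
    (hW : IsIndObject W) : IsIndObject (F.op ⋙ W) := by
  have p := hW.presentation
  exact ObjectProperty.prop_of_isColimit (P := IsIndObject)
    (isColimitOfPreserves ((Functor.whiskeringLeft _ _ (Type v)).obj F.op) p.isColimit)
    (fun i => (isIndObject_yoneda _).map (hF (p.F.obj i)).has_representation.choose_spec.some.toIso.hom)
end

section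
variable {C : Type u} [Category.{v} C]

/-- The product of a family of presheaves. -/
@[simps]
def piPresheaf {ι : Type} (R : ι → Cᵒᵖ ⥤ Type v) : Cᵒᵖ ⥤ Type v where
  obj X := ∀ i, (R i).obj X
  map f := ↾fun r i => (R i).map f (r i)

lemma isIndObject_piPresheaf [HasFiniteLimits C] {ι : Type} (R : ι → Cᵒᵖ ⥤ Type v)
    (hR : ∀ i, IsIndObject (R i)) (s : Finset ι)
    (hs : ∀ i ∉ s, ∀ X, Nonempty (Unique ((R i).obj X))) : IsIndObject (piPresheaf R) := by
  classical
  let J := ULift.{v} s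
  let R' : J → Cᵒᵖ ⥤ Type v := fun j => R j.down
  let c : Fan R' := Fan.mk (piPresheaf R) (fun j => { app X := ↾fun r => r j.down })
  have hc : IsLimit c := by
    refine evaluationJointlyReflectsLimits _ (fun X => ?_)
    refine ((Types.isLimit_iff _).2 (fun t ht => ?_)).some
    let u : ∀ i ∉ s, Unique ((R i).obj X) := fun i hi => (hs i hi X).some
    refine ⟨fun i => if hi : i ∈ s then t ⟨⟨i, hi⟩⟩ else (u i hi).default, ?_, ?_⟩
    · rintro ⟨⟨i, hi⟩⟩
      exact dif_pos hi
    · intro y hy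
      funext i
      by_cases hi : i ∈ s
      · refine Eq.trans ?_ (dif_pos hi).symm
        exact hy ⟨⟨i, hi⟩⟩
      · refine Eq.trans ?_ (dif_neg hi).symm
        exact (u i hi).uniq _
  have : HasLimitsOfShape (Discrete J) C := inferInstance
  exact ObjectProperty.prop_of_isLimit (P := IsIndObject) hc (fun j => hR _)

lemma isIndObject_of_equations [HasFiniteLimits C] {R S P : Cᵒᵖ ⥤ Type v}
    (hR : IsIndObject R) (hS : IsIndObject S) (ι : P ⟶ R) (f g : R ⟶ S)
    (w : ι ≫ f = ι ≫ g)
    (h : ∀ X (r : R.obj X), f.app X r = g.app X r → ∃! p : P.obj X, ι.app X p = r) :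
    IsIndObject P := by
  have hc : IsLimit (Fork.ofι ι w) := by
    refine evaluationJointlyReflectsLimits _ (fun X => ?_)
    refine (isLimitMapConeForkEquiv ((evaluation _ _).obj X) w).symm ?_
    exact Types.typeEqualizerOfUnique _ _ (h X)
  refine ObjectProperty.prop_of_isLimit (P := IsIndObject) hc ?_
  rintro (_ | _)
  · exact hR
  · exact hS
end

/-! ### Bounded complexes -/

section

variable (B : Type u) [Category.{v} B]

/-- Bounded cochain complexes. -/
def boundedComplex [HasZeroMorphisms B] : ObjectProperty (CochainComplex B ℤ) :=
  fun K => ∃ a b : ℤ, K.IsStrictlyGE a ∧ K.IsStrictlyLE b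

/-- The category `C^b(B)` of bounded cochain complexes. -/
abbrev Cb [HasZeroMorphisms B] := (boundedComplex B).FullSubcategory

instance [HasZeroMorphisms B] (J : Type*) [SmallCategory J] [FinCategory J] [HasLimitsOfShape J B] :
    (boundedComplex B).IsClosedUnderLimitsOfShape J where
  limitsOfShape_le := by
    classical
    rintro K ⟨p⟩
    choose a b ha hb using p.prop_diag_obj
    refine ⟨Finset.min' (Finset.image a ⊤ ∪ {0}) ⟨0, by grind⟩,
      Finset.max' (Finset.image b ⊤ ∪ {0}) ⟨0, by grind⟩, ?_, ?_⟩
    · rw [CochainComplex.isStrictlyGE_iff]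
      intro i hi
      rw [IsZero.iff_id_eq_zero]
      refine (isLimitOfPreserves (HomologicalComplex.eval _ _ i) p.isLimit).hom_ext
        (fun j ↦ ((p.diag.obj j).isZero_of_isStrictlyGE (a j) i ?_).eq_of_tgt _ _)
      exact lt_of_lt_of_le hi (Finset.min'_le _ (a j) (by simp))
    · rw [CochainComplex.isStrictlyLE_iff]
      intro i hi
      rw [IsZero.iff_id_eq_zero]
      refine (isLimitOfPreserves (HomologicalComplex.eval _ _ i) p.isLimit).hom_ext
        (fun j ↦ ((p.diag.obj j).isZero_of_isStrictlyLE (b j) i ?_).eq_of_tgt _ _)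
      exact lt_of_le_of_lt (Finset.le_max' _ (b j) (by simp)) hi

instance [HasZeroMorphisms B] (J : Type*) [SmallCategory J] [FinCategory J] [HasColimitsOfShape J B] :
    (boundedComplex B).IsClosedUnderColimitsOfShape J where
  colimitsOfShape_le := by
    classical
    rintro K ⟨p⟩
    choose a b ha hb using p.prop_diag_obj
    refine ⟨Finset.min' (Finset.image a ⊤ ∪ {0}) ⟨0, by grind⟩,
      Finset.max' (Finset.image b ⊤ ∪ {0}) ⟨0, by grind⟩, ?_, ?_⟩
    · rw [CochainComplex.isStrictlyGE_iff]
      intro i hi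
      rw [IsZero.iff_id_eq_zero]
      refine (isColimitOfPreserves (HomologicalComplex.eval _ _ i) p.isColimit).hom_ext
        (fun j ↦ ((p.diag.obj j).isZero_of_isStrictlyGE (a j) i ?_).eq_of_src _ _)
      exact lt_of_lt_of_le hi (Finset.min'_le _ (a j) (by simp))
    · rw [CochainComplex.isStrictlyLE_iff]
      intro i hi
      rw [IsZero.iff_id_eq_zero]
      refine (isColimitOfPreserves (HomologicalComplex.eval _ _ i) p.isColimit).hom_ext
        (fun j ↦ ((p.diag.obj j).isZero_of_isStrictlyLE (b j) i ?_).eq_of_src _ _)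
      exact lt_of_le_of_lt (Finset.le_max' _ (b j) (by simp)) hi

instance [HasZeroMorphisms B] [HasFiniteLimits B] : HasFiniteLimits (Cb B) where
  out J _ _ := by infer_instance

instance [HasZeroMorphisms B] [HasFiniteColimits B] : HasFiniteColimits (Cb B) where
  out J _ _ := by infer_instance

variable {B}

/-- Degree `i` of a bounded complex. -/
abbrev evalCb [HasZeroMorphisms B] (i : ℤ) : Cb B ⥤ B :=
  (boundedComplex B).ι ⋙ HomologicalComplex.eval B _ i

open HomologicalComplex

variable [HasZeroMorphisms B] [HasZeroObject B]

/-- The complex `d = d` in degrees `i` and `i + 1`. -/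
noncomputable abbrev disk (d : B) (i : ℤ) : CochainComplex B ℤ :=
  double (𝟙 d) (show (ComplexShape.up ℤ).Rel i (i + 1) from rfl)

/-- The object of `disk d i` in degree `i`. -/
noncomputable abbrev diskIso₀ (d : B) (i : ℤ) : (disk d i).X i ≅ d := doubleXIso₀ _ _

/-- The object of `disk d i` in degree `i + 1`. -/
noncomputable abbrev diskIso₁ (d : B) (i : ℤ) : (disk d i).X (i + 1) ≅ d :=
  doubleXIso₁ _ _ (by simp)

lemma disk_d (d : B) (i : ℤ) :
    (disk d i).d i (i + 1) = (diskIso₀ d i).hom ≫ (diskIso₁ d i).inv := by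
  simp [double_d]

lemma boundedComplex_disk (d : B) (i : ℤ) : boundedComplex B (disk d i) := by
  refine ⟨i, i + 1, ?_, ?_⟩
  · rw [CochainComplex.isStrictlyGE_iff]
    intro j hj
    exact isZero_double_X _ _ _ (by lia) (by lia)
  · rw [CochainComplex.isStrictlyLE_iff]
    intro j hj
    exact isZero_double_X _ _ _ (by lia) (by lia)

open scoped Classical in
/-- The morphism to `disk d i` determined by its component in degree `i + 1`. -/
noncomputable def toDisk {K : CochainComplex B ℤ} {d : B} {i : ℤ} (φ : K.X (i + 1) ⟶ d) :
    K ⟶ disk d i where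
  f k :=
    if hk₀ : k = i then
      (K.XIsoOfEq hk₀).hom ≫ K.d i (i + 1) ≫ φ ≫ (diskIso₀ d i).inv ≫
        ((disk d i).XIsoOfEq hk₀).inv
    else if hk₁ : k = i + 1 then
      (K.XIsoOfEq hk₁).hom ≫ φ ≫ (diskIso₁ d i).inv ≫ ((disk d i).XIsoOfEq hk₁).inv
    else 0
  comm' k₀ k₁ hk := by
    obtain rfl : k₀ + 1 = k₁ := hk
    by_cases h₀ : k₀ = i
    · subst h₀
      simp [disk_d]
    · by_cases h₁ : k₀ + 1 = i
      · subst h₁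
        rw [double_d_eq_zero₀ _ _ _ _ h₀, comp_zero]
        simp
      · exact (isZero_double_X _ _ _ h₁ (by lia)).eq_of_tgt _ _

@[simp]
lemma toDisk_f_succ {K : CochainComplex B ℤ} {d : B} {i : ℤ} (φ : K.X (i + 1) ⟶ d) :
    (toDisk φ).f (i + 1) = φ ≫ (diskIso₁ d i).inv := by
  simp [toDisk]

@[simp]
lemma toDisk_f {K : CochainComplex B ℤ} {d : B} {i : ℤ} (φ : K.X (i + 1) ⟶ d) :
    (toDisk φ).f i = K.d i (i + 1) ≫ φ ≫ (diskIso₀ d i).inv := by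
  simp [toDisk]

lemma isRepresentable_evalCb (i : ℤ) (d : B) :
    ((evalCb (B := B) i).op ⋙ yoneda.obj d).IsRepresentable := by
  obtain ⟨i, rfl⟩ : ∃ j, i = j + 1 := ⟨i - 1, by lia⟩
  have hl : ∀ {K : CochainComplex B ℤ} (g : K ⟶ disk d i),
      toDisk (g.f (i + 1) ≫ (diskIso₁ d i).hom) = g := fun {K} g => by
    apply to_double_hom_ext
    · have h := g.comm i (i + 1)
      rw [disk_d] at h
      rw [toDisk_f, Category.assoc, ← reassoc_of% h]
      simp
    · simp
  have hr : ∀ {K : CochainComplex B ℤ} (φ : K.X (i + 1) ⟶ d),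
      (toDisk φ).f (i + 1) ≫ (diskIso₁ d i).hom = φ := fun {K} φ => by simp
  exact Functor.RepresentableBy.isRepresentable (Y := ⟨_, boundedComplex_disk d i⟩)
    { homEquiv := fun {K} =>
        { toFun g := g.hom.f (i + 1) ≫ (diskIso₁ d i).hom
          invFun φ := ⟨toDisk φ⟩
          left_inv g := by
            ext : 1
            exact hl g.hom
          right_inv φ := hr φ }
      homEquiv_comp := fun f g => Category.assoc _ _ _ }

lemma isRepresentable_evalCb_op (i : ℤ) (d : Bᵒᵖ) :
    ((evalCb (B := B) i).op.op ⋙ yoneda.obj d).IsRepresentable := by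
  let e := evalCompCoyonedaCorepresentableByDoubleId (C := B)
    (show (ComplexShape.up ℤ).Rel i (i + 1) from rfl) (by simp) d.unop
  refine Functor.RepresentableBy.isRepresentable (Y := op ⟨_, boundedComplex_disk d.unop i⟩)
    { homEquiv := fun {K} => ((opEquiv _ _).trans
        (((boundedComplex B).fullyFaithfulι.homEquiv).trans e.homEquiv)).trans (opEquiv _ _).symm
      homEquiv_comp := ?_ }
  intro K K' f g
  apply Quiver.Hom.unop_inj
  exact e.homEquiv_comp _ _

end

section
variable {A : Type u₁} [Category.{v} A] [HasZeroMorphisms A] [HasZeroObject A]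
  {B : Type u₂} [Category.{v} B] [HasZeroMorphisms B]

/-- The functor `C^b(A) ⥤ C^b(B)` that applies `E : A ⥤ B` in each degree. -/
noncomputable def mapCb (E : A ⥤ B) [E.PreservesZeroMorphisms] : Cb A ⥤ Cb B :=
  ObjectProperty.lift _ ((boundedComplex A).ι ⋙ E.mapHomologicalComplex (.up ℤ)) (fun K => by
    obtain ⟨a, b, _, _⟩ := K.property
    refine ⟨a, b, ?_, ?_⟩ <;> dsimp <;> infer_instance)

lemma isIndObject_mapCb [HasFiniteLimits A] (E : A ⥤ B) [E.PreservesZeroMorphisms]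
    (hE : ∀ W : B, IsIndObject (E.op ⋙ yoneda.obj W)) (Z : Cb B) :
    IsIndObject ((mapCb E).op ⋙ yoneda.obj Z) := by
  obtain ⟨a, b, ha, hb⟩ := Z.property
  have hZ : ∀ i, i < a ∨ b < i → IsZero (Z.obj.X i) := fun i hi =>
    hi.elim (fun h => Z.obj.isZero_of_isStrictlyGE a i h)
      (fun h => Z.obj.isZero_of_isStrictlyLE b i h)
  have hev : ∀ (i j : ℤ), IsIndObject ((evalCb (B := A) i).op ⋙ E.op ⋙ yoneda.obj (Z.obj.X j)) :=
    fun i j => isIndObject_comp_of_isRepresentable _ (isRepresentable_evalCb i) (hE _)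
  let R : ℤ → (Cb A)ᵒᵖ ⥤ Type v := fun i => (evalCb i).op ⋙ E.op ⋙ yoneda.obj (Z.obj.X i)
  let S : ℤ → (Cb A)ᵒᵖ ⥤ Type v := fun i => (evalCb i).op ⋙ E.op ⋙ yoneda.obj (Z.obj.X (i + 1))
  have hR : IsIndObject (piPresheaf R) :=
    isIndObject_piPresheaf R (fun i => hev _ _) (Finset.Icc (a - 1) b) (fun i hi X =>
      (hZ i (by rw [Finset.mem_Icc] at hi; lia)).unique_from _)
  have hS : IsIndObject (piPresheaf S) :=
    isIndObject_piPresheaf S (fun i => hev _ _) (Finset.Icc (a - 1) b) (fun i hi X =>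
      (hZ (i + 1) (by rw [Finset.mem_Icc] at hi; lia)).unique_from _)
  refine isIndObject_of_equations hR hS
    { app X := ↾fun φ i => φ.hom.f i }
    { app X := ↾fun r i => (r i : E.obj (X.unop.obj.X i) ⟶ Z.obj.X i) ≫ Z.obj.d i (i + 1)
      naturality := ?_ }
    { app X := ↾fun r i => E.map (X.unop.obj.d i (i + 1)) ≫
        (r (i + 1) : E.obj (X.unop.obj.X (i + 1)) ⟶ Z.obj.X (i + 1))
      naturality := ?_ } ?_ ?_
  · intro X Y f
    ext r
    funext i
    exact Category.assoc _ _ _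
  · intro X Y f
    ext r
    funext i
    have h := congr_arg E.map (f.unop.hom.comm i (i + 1))
    rw [E.map_comp, E.map_comp] at h
    exact ((Category.assoc _ _ _).symm.trans
      (congr_arg (· ≫ (r (i + 1) : E.obj (X.unop.obj.X (i + 1)) ⟶ Z.obj.X (i + 1))) h.symm)).trans
        (Category.assoc _ _ _)
  · ext X φ
    funext i
    exact φ.hom.comm i (i + 1)
  · intro X r hr
    refine ⟨⟨{ f i := r i, comm' := ?_ }⟩, rfl, ?_⟩
    · rintro i _ rfl
      exact congr_fun hr i
    · intro φ hφ
      exact ObjectProperty.hom_ext _ (HomologicalComplex.hom_ext _ _ (fun i => congr_fun hφ i))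

lemma isIndObject_mapCb_op [HasFiniteColimits A] (E : A ⥤ B) [E.PreservesZeroMorphisms]
    (hE : ∀ W : Bᵒᵖ, IsIndObject (E.op.op ⋙ yoneda.obj W)) (Z : (Cb B)ᵒᵖ) :
    IsIndObject ((mapCb E).op.op ⋙ yoneda.obj Z) := by
  obtain ⟨a, b, ha, hb⟩ := Z.unop.property
  have hZ : ∀ i, i < a ∨ b < i → IsZero (Z.unop.obj.X i) := fun i hi =>
    hi.elim (fun h => Z.unop.obj.isZero_of_isStrictlyGE a i h)
      (fun h => Z.unop.obj.isZero_of_isStrictlyLE b i h)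
  have hev : ∀ (i j : ℤ), IsIndObject
      ((evalCb (B := A) i).op.op ⋙ E.op.op ⋙ yoneda.obj (op (Z.unop.obj.X j))) :=
    fun i j => isIndObject_comp_of_isRepresentable _ (isRepresentable_evalCb_op i) (hE _)
  let R : ℤ → (Cb A)ᵒᵖᵒᵖ ⥤ Type v := fun i =>
    (evalCb i).op.op ⋙ E.op.op ⋙ yoneda.obj (op (Z.unop.obj.X i))
  let S : ℤ → (Cb A)ᵒᵖᵒᵖ ⥤ Type v := fun i =>
    (evalCb (i + 1)).op.op ⋙ E.op.op ⋙ yoneda.obj (op (Z.unop.obj.X i))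
  have hR : IsIndObject (piPresheaf R) :=
    isIndObject_piPresheaf R (fun i => hev _ _) (Finset.Icc (a - 1) b) (fun i hi X =>
      (hZ i (by rw [Finset.mem_Icc] at hi; lia)).op.unique_from _)
  have hS : IsIndObject (piPresheaf S) :=
    isIndObject_piPresheaf S (fun i => hev _ _) (Finset.Icc (a - 1) b) (fun i hi X =>
      (hZ i (by rw [Finset.mem_Icc] at hi; lia)).op.unique_from _)
  refine isIndObject_of_equations hR hS
    { app X := ↾fun φ i => (φ.unop.hom.f i).op }
    { app X := ↾fun r i => (E.map (X.unop.unop.obj.d i (i + 1))).op ≫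
        (r i : op (E.obj (X.unop.unop.obj.X i)) ⟶ op (Z.unop.obj.X i))
      naturality := ?_ }
    { app X := ↾fun r i =>
        (r (i + 1) : op (E.obj (X.unop.unop.obj.X (i + 1))) ⟶ op (Z.unop.obj.X (i + 1))) ≫
          (Z.unop.obj.d i (i + 1)).op
      naturality := ?_ } ?_ ?_
  · intro X Y f
    ext r
    funext i
    have h := congr_arg (fun g => (E.map g).op) (f.unop.unop.hom.comm i (i + 1))
    simp only [E.map_comp, op_comp] at h
    exact ((Category.assoc _ _ _).symm.trans
      (congr_arg (· ≫ (r i : op (E.obj (X.unop.unop.obj.X i)) ⟶ op (Z.unop.obj.X i))) h)).trans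
        (Category.assoc _ _ _)
  · intro X Y f
    ext r
    funext i
    exact Category.assoc _ _ _
  · ext X φ
    funext i
    exact congr_arg Quiver.Hom.op (φ.unop.hom.comm i (i + 1))
  · intro X r hr
    refine ⟨Quiver.Hom.op ⟨{ f i := (r i).unop, comm' := ?_ }⟩, rfl, ?_⟩
    · rintro i _ rfl
      exact congr_arg Quiver.Hom.unop (congr_fun hr i)
    · intro φ hφ
      apply Quiver.Hom.unop_inj
      ext i
      exact congr_arg Quiver.Hom.unop (congr_fun hφ i)

end

/-! ### Pro-objects, ind-adjoints and pro-adjoints -/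

section

variable {C : Type u₁} [Category.{v} C] {D : Type u₂} [Category.{v} D]

/-- The category of pro-objects, `Pro(C) = Ind(Cᵒᵖ)ᵒᵖ`. -/
abbrev Pro (C : Type u) [Category.{v} C] := (Ind Cᵒᵖ)ᵒᵖ

/-- The embedding `C ⥤ Pro(C)`. -/
noncomputable abbrev proYoneda : C ⥤ Pro C := (Ind.yoneda (C := Cᵒᵖ)).rightOp

/-- The functor `Pro(F) : Pro(C) ⥤ Pro(D)` that extends `F : C ⥤ D` by the formula
`Pro(F)("lim" Xᵢ) = "lim" F(Xᵢ)`. -/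
noncomputable def proMap (F : C ⥤ D) : Pro C ⥤ Pro D := (indMap F.op).op

/-- The ind-adjoint `D ⥤ Ind(C)` of a functor `F : C ⥤ D`: it sends `Z` to the ind-object
`X ↦ Hom_D(F(X), Z)`, so that `Hom_{Ind(C)}(X, indAdjoint F Z) = Hom_D(F(X), Z)`. -/
noncomputable def indAdjoint (F : C ⥤ D) (h : ∀ Z : D, IsIndObject (F.op ⋙ yoneda.obj Z)) :
    D ⥤ Ind C :=
  ObjectProperty.lift IsIndObject
    (yoneda ⋙ (Functor.whiskeringLeft _ _ (Type v)).obj F.op) h ⋙ (Ind.equivalence C).inverse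

/-- The pro-adjoint `D ⥤ Pro(C)` of a functor `F : C ⥤ D`, defined by
`Hom_{Pro(C)}(proAdjoint F Z, X) = Hom_D(Z, F(X))`. -/
noncomputable def proAdjoint (F : C ⥤ D)
    (h : ∀ Z : Dᵒᵖ, IsIndObject (F.op.op ⋙ yoneda.obj Z)) : D ⥤ Pro C :=
  (indAdjoint F.op h).rightOp

lemma isIndObject_indYoneda (W : Ind C) : IsIndObject (Ind.yoneda.op ⋙ yoneda.obj W) := by
  let e : Ind.yoneda.op ⋙ yoneda.obj W ≅ (Ind.inclusion C).obj W :=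
    NatIso.ofComponents (fun X => Equiv.toIso
      (Ind.inclusion.fullyFaithful.homEquiv.trans
        ((Ind.yonedaCompInclusion.app X.unop).homFromEquiv.trans yonedaEquiv))) (by
      intro X Y f
      ext g
      have h := Ind.yonedaCompInclusion.inv.naturality f.unop
      have h' := yonedaEquiv_naturality
        (Ind.yonedaCompInclusion.inv.app X.unop ≫ (Ind.inclusion C).map g) f.unop
      refine Eq.trans (congr_arg yonedaEquiv ?_) h'.symm
      change Ind.yonedaCompInclusion.inv.app Y.unop ≫
        (Ind.inclusion C).map (Ind.yoneda.map f.unop ≫ g) = _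
      rw [Functor.map_comp]
      exact (reassoc_of% h) _ |>.symm)
  exact IsIndObject.map e.inv W.isIndObject_inclusion_obj

lemma isIndObject_proYoneda (W : (Pro C)ᵒᵖ) : IsIndObject (proYoneda.op.op ⋙ yoneda.obj W) := by
  let e : Ind.yoneda.op ⋙ yoneda.obj W.unop.unop ≅ proYoneda.op.op ⋙ yoneda.obj W :=
    NatIso.ofComponents (fun X => Equiv.toIso ((opEquiv _ _).trans (opEquiv _ _)).symm)
  exact IsIndObject.map e.hom (isIndObject_indYoneda W.unop.unop)
end

/-! ### The comparison functors -/

section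

variable (A : Type u) [Category.{v} A] [Abelian A]

instance : (Ind.yoneda (C := A)).Additive := Functor.additive_of_preserves_binary_products _

instance : (proYoneda (C := A)).Additive := inferInstance

/-- The functor `C^b(Ind(A)) ⥤ Ind(C^b(A))` that rewrites a bounded complex of ind-objects as a
filtered system of (uniformly) bounded complexes. It is the ind-adjoint of the canonical functor
`C^b(A) ⥤ C^b(Ind(A))`. -/
noncomputable def indComplex : Cb (Ind A) ⥤ Ind (Cb A) :=
  indAdjoint (mapCb Ind.yoneda) (isIndObject_mapCb _ isIndObject_indYoneda)

/-- The functor `C^b(Pro(A)) ⥤ Pro(C^b(A))` that rewrites a bounded complex of pro-objects as a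
cofiltered system of (uniformly) bounded complexes. It is the pro-adjoint of the canonical functor
`C^b(A) ⥤ C^b(Pro(A))`. -/
noncomputable def proComplex : Cb (Pro A) ⥤ Pro (Cb A) :=
  proAdjoint (mapCb proYoneda) (isIndObject_mapCb_op _ isIndObject_proYoneda)

section

variable [HasDerivedCategory.{w} A]

/-- The canonical functor `C^b(A) ⥤ D^b(A)`. -/
noncomputable def Qb : Cb A ⥤ DerivedCategory.Bounded A :=
  ObjectProperty.lift _ ((boundedComplex A).ι ⋙ DerivedCategory.Q) (fun K => by
    obtain ⟨a, b, ha, hb⟩ := K.property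
    exact ⟨⟨a, ⟨⟨K.obj, Iso.refl _, ha⟩⟩⟩, ⟨b, ⟨⟨K.obj, Iso.refl _, hb⟩⟩⟩⟩)

/-- The objects of `D^b(A)` whose cohomology vanishes outside the degrees `-N, …, N`. -/
def cohomologyIn (N : ℕ) : ObjectProperty (DerivedCategory.Bounded A) :=
  fun X => ∀ i : ℤ, i ∉ Set.Icc (-(N : ℤ)) N →
    IsZero ((DerivedCategory.homologyFunctor A i).obj (DerivedCategory.Bounded.ι.obj X))

end

variable [HasDerivedCategory.{v} A]

/-- The objects of `Ind(D^b(A))` that can be given by a small filtered system in `D^b(A)` with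
uniformly bounded cohomology. -/
def uniformlyBoundedInd : ObjectProperty (Ind (DerivedCategory.Bounded A)) :=
  fun X => ∃ (P : IndObjectPresentation ((Ind.inclusion _).obj X)) (N : ℕ),
    ∀ i : P.I, cohomologyIn A N (P.F.obj i)

/-- The category `ind(D^b(A))`, a full subcategory of `Ind(D^b(A))`. -/
abbrev IndDb := (uniformlyBoundedInd A).FullSubcategory

/-- The objects of `Pro(D^b(A))` that can be given by a small cofiltered system in `D^b(A)` with
uniformly bounded cohomology. -/
def uniformlyBoundedPro : ObjectProperty (Pro (DerivedCategory.Bounded A)) :=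
  fun X => ∃ (P : IndObjectPresentation ((Ind.inclusion _).obj X.unop)) (N : ℕ),
    ∀ i : P.I, cohomologyIn A N (P.F.obj i).unop

/-- The category `pro(D^b(A))`, a full subcategory of `Pro(D^b(A))`. -/
abbrev ProDb := (uniformlyBoundedPro A).FullSubcategory

variable {A}

/-- `J : D^b(Ind(A)) ⥤ ind(D^b(A))` is (up to isomorphism) the natural functor: it is induced by
`C^b(Ind(A)) ⥤ Ind(C^b(A))`, in the sense that the square
```
C^b(Ind(A)) ⥤ Ind(C^b(A))
     |             |
D^b(Ind(A)) ⥤ Ind(D^b(A))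
```
commutes up to isomorphism. -/
def IsNaturalInd [HasDerivedCategory.{w} (Ind A)]
    (J : DerivedCategory.Bounded (Ind A) ⥤ IndDb A) : Prop :=
  Nonempty (Qb (Ind A) ⋙ J ⋙ (uniformlyBoundedInd A).ι ≅ indComplex A ⋙ indMap (Qb A))

/-- `J : D^b(Pro(A)) ⥤ pro(D^b(A))` is (up to isomorphism) the natural functor: it is induced by
`C^b(Pro(A)) ⥤ Pro(C^b(A))`, in the sense that the square
```
C^b(Pro(A)) ⥤ Pro(C^b(A))
     |             |
D^b(Pro(A)) ⥤ Pro(D^b(A))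
```
commutes up to isomorphism. -/
def IsNaturalPro [HasDerivedCategory.{w} (Pro A)]
    (J : DerivedCategory.Bounded (Pro A) ⥤ ProDb A) : Prop :=
  Nonempty (Qb (Pro A) ⋙ J ⋙ (uniformlyBoundedPro A).ι ≅ proComplex A ⋙ proMap (Qb A))

end

end IndPro

/-!
The theorem follows from a description of the morphisms from `D^b(A)` to the objects of
`D^b(Ind(A))`. Write `Q` for both functors `C^b ⥤ D^b` and let `Z` be a bounded complex of
ind-objects. For `X` in `D^b(A)`, a morphism from `X` to the ind-object `Ind(Q)(J Z)` is represented
by a morphism `X ⟶ Q(Y)` in `D^b(A)` and a morphism of complexes `Y ⟶ Z`, with `Y` in `C^b(A)`.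
Composition gives a morphism `X ⟶ Q(Z)` in `D^b(Ind(A))`, and the assertion is that this is a
bijection `Hom(X, Ind(Q)(J Z)) ≃ Hom(X, Q(Z))` (`FractionSquare.homEquiv`).

The bijection comes from the property `RefinesEpi` of the embedding of `A` in `Ind(A)`: every
epimorphism from an ind-object to an object `U` of `A` is dominated by an epimorphism `V ⟶ U` of
`A`. By descending induction on degrees, a morphism from a bounded complex `X` of `A` to an acyclic
bounded below complex of ind-objects becomes null-homotopic on some quasi-isomorphic `X' ⟶ X` with
`X'` in `C^b(A)` (`RefinesEpi.exists_homotopy_zero`). Applied to the cone of a denominator, this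
represents every morphism `Q(X) ⟶ Q(Z)` by a fraction `X ⟵ X' ⟶ Z` with denominator in `C^b(A)`,
which is surjectivity. Applied to a cocone, it shows that a morphism `Y ⟶ Z` that vanishes in
`D^b(Ind(A))` is null-homotopic on some `Y'` quasi-isomorphic to `Y`; a null-homotopic morphism
factors through the cone of the identity of `Y'`, which is an acyclic complex of `A`, and
injectivity follows.

Since an ind-object of `D^b(A)` is determined by the morphisms to it from objects of `D^b(A)`,
the bijection shows that `Z ↦ Ind(Q)(J Z)` depends only on `Q(Z)`, functorially: this is
`FractionSquare.exists_functor`. The values are uniformly bounded because a morphism `Y ⟶ Z` to a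
complex in degrees `-N, …, N` factors through a quotient of `Y` in these degrees
(`exists_bounded_fac`).

For conservativity, every morphism of `D^b(Ind(A))` is, up to isomorphisms, `Q(g)` for a morphism
`g : Z ⟶ Z'` of complexes. If its image is an isomorphism, then `Hom(X, Q(Z)) ⟶ Hom(X, Q(Z'))` is
bijective for every `X` in `D^b(A)`. Taking for `X` the objects `U` of `A` placed in a single
degree, one sees that they have no nonzero morphism to the cone of `g`. As ind-objects are generated
by the objects of `A`, so are the cycles of the cone, and its homology vanishes.

The category `Ind(A)` enters only through exactness of `A ⥤ Ind(A)`, existence of the ind-adjoint,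
`RefinesEpi`, and generation by `A`. The proof for `Pro(A)` uses the dual properties
(`RefinesMono`, and cogeneration by `A`); it runs through the same `FractionSquare`, taken in the
opposite categories.
-/

namespace IndPro

universe w' u₃ u₄

/-! ### Disks and replacements up to quasi-isomorphism -/

section

variable {A : Type u} [Category.{v} A]

/-- A morphism `g : K.X (i + 1) ⟶ L.X i`, regarded as a homotopy with a single component, defines a
null-homotopic morphism; it is concentrated in degrees `i` and `i + 1`. -/
lemma exists_nullHomotopic_of_component [Preadditive A] {K L : CochainComplex A ℤ} (i : ℤ)
    (g : K.X (i + 1) ⟶ L.X i) :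
    ∃ φ : K ⟶ L, Nonempty (Homotopy φ 0) ∧ φ.f i = K.d i (i + 1) ≫ g ∧
      φ.f (i + 1) = g ≫ L.d i (i + 1) ∧ ∀ j, j ≠ i → j ≠ i + 1 → φ.f j = 0 := by
  let h (p q : ℤ) (hpq : (ComplexShape.up ℤ).Rel q p) : K.X p ⟶ L.X q :=
    if hq : q = i then
      (K.XIsoOfEq (show p = i + 1 from hpq.symm.trans (by rw [hq]))).hom ≫ g ≫
        (L.XIsoOfEq hq.symm).hom
    else 0
  have e (j : ℤ) : (Homotopy.nullHomotopicMap' h).f j =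
      K.d j (j + 1) ≫ h (j + 1) j rfl +
        h j (j - 1) (sub_add_cancel j 1) ≫ L.d (j - 1) j :=
    Homotopy.nullHomotopicMap'_f (sub_add_cancel j 1) rfl h
  have h₁ : h (i + 1) i rfl = g := by simp [h]
  have h₂ : h (i + 1) (i + 1 - 1) (sub_add_cancel _ 1) ≫ L.d (i + 1 - 1) (i + 1) =
      g ≫ L.d i (i + 1) := by
    have : ∀ (q : ℤ) (hq : q + 1 = i + 1), h (i + 1) q hq ≫ L.d q (i + 1) =
        g ≫ L.d i (i + 1) := by
      intro q hq
      obtain rfl : q = i := add_right_cancel hq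
      rw [← h₁]
    exact this _ (sub_add_cancel _ 1)
  have h₃ (p q : ℤ) (hpq : (ComplexShape.up ℤ).Rel q p) (hq : q ≠ i) : h p q hpq = 0 :=
    dif_neg hq
  refine ⟨Homotopy.nullHomotopicMap' h, ⟨Homotopy.nullHomotopy' h⟩, ?_, ?_, ?_⟩
  · rw [e, h₁, h₃ i (i - 1) (sub_add_cancel i 1) (by simp), zero_comp, add_zero]
  · rw [e, h₂, h₃ (i + 1 + 1) (i + 1) rfl (by simp), comp_zero, zero_add]
  · intro j hj hj'
    rw [e, h₃ (j + 1) j rfl hj, h₃ j (j - 1) (sub_add_cancel j 1)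
      (fun hq => hj' (eq_add_of_sub_eq hq)), comp_zero, zero_comp,
      zero_add]

variable [Abelian A]

lemma acyclic_disk (d : A) (i : ℤ) : (disk d i).Acyclic := by
  obtain ⟨φ, ⟨h⟩, h₁, h₂, -⟩ := exists_nullHomotopic_of_component (K := disk d i)
    (L := disk d i) i ((diskIso₁ d i).hom ≫ (diskIso₀ d i).inv)
  obtain rfl : φ = 𝟙 _ := by
    apply HomologicalComplex.to_double_hom_ext
    · simp [h₁, disk_d]
    · simp [h₂, disk_d]
  intro n
  rw [HomologicalComplex.exactAt_iff_isZero_homology, IsZero.iff_id_eq_zero,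
    ← HomologicalComplex.homologyMap_id, h.homologyMap_eq, HomologicalComplex.homologyMap_zero]

lemma isZero_Q_obj_iff [HasDerivedCategory.{w} A] (K : CochainComplex A ℤ) :
    IsZero (DerivedCategory.Q.obj K) ↔ K.Acyclic := by
  have e (i : ℤ) := (DerivedCategory.homologyFunctorFactors A i).app K
  refine ⟨fun hK i => ?_, fun hK => ?_⟩
  · rw [HomologicalComplex.exactAt_iff_isZero_homology]
    exact ((DerivedCategory.homologyFunctor A i).map_isZero hK).of_iso (e i).symm
  -- If `K` is acyclic, its zero endomorphism is a quasi-isomorphism.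
  · have : QuasiIso (0 : K ⟶ K) := by
      rw [quasiIso_iff]
      intro i
      rw [quasiIsoAt_iff_exactAt' _ _ (hK i)]
      exact hK i
    rw [IsZero.iff_id_eq_zero, ← cancel_mono (DerivedCategory.Q.map (0 : K ⟶ K))]
    simp

/-- The kernel of `g` is acyclic, and `t` has the same kernel. -/
lemma quasiIso_of_isPullback {K L M N : CochainComplex A ℤ} {t : K ⟶ L} {p : K ⟶ M}
    {f : L ⟶ N} {g : M ⟶ N} (h : IsPullback t p f g) [Epi g] (hM : M.Acyclic) (hN : N.Acyclic) :
    QuasiIso t := by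
  let := HasDerivedCategory.standard A
  have : Epi t := Abelian.epi_fst_of_isLimit _ _ h.isLimit
  have hg : (ShortComplex.mk _ _ (kernel.condition g)).ShortExact :=
    { exact := ShortComplex.exact_of_f_is_kernel _ (kernelIsKernel g) }
  have ht : (ShortComplex.mk _ _ (kernel.condition t)).ShortExact :=
    { exact := ShortComplex.exact_of_f_is_kernel _ (kernelIsKernel t) }
  rw [← isZero_Q_obj_iff] at hM hN
  have hK : IsZero (DerivedCategory.Q.obj (kernel g)) :=
    (Pretriangulated.Triangle.isZero₁_iff_isIso₂ _
      (DerivedCategory.triangleOfSES_distinguished hg)).2 (hM.isIso hN _)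
  have := isIso_kernel_map_of_isPullback h
  rw [← DerivedCategory.isIso_Q_map_iff_quasiIso]
  exact (Pretriangulated.Triangle.isZero₁_iff_isIso₂ _
    (DerivedCategory.triangleOfSES_distinguished ht)).1
      (hK.of_iso (DerivedCategory.Q.mapIso (asIso (kernel.map _ _ _ _ h.w))))

/-- The cokernel of `g` is acyclic, and `t` has the same cokernel. -/
lemma quasiIso_of_isPushout {K L M N : CochainComplex A ℤ} {g : K ⟶ L} {f : K ⟶ M}
    {p : L ⟶ N} {t : M ⟶ N} (h : IsPushout g f p t) [Mono g] (hK : K.Acyclic) (hL : L.Acyclic) :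
    QuasiIso t := by
  let := HasDerivedCategory.standard A
  have : Mono t := Abelian.mono_inr_of_isColimit _ _ h.isColimit
  have hg : (ShortComplex.mk _ _ (cokernel.condition g)).ShortExact :=
    { exact := ShortComplex.exact_of_g_is_cokernel _ (cokernelIsCokernel g) }
  have ht : (ShortComplex.mk _ _ (cokernel.condition t)).ShortExact :=
    { exact := ShortComplex.exact_of_g_is_cokernel _ (cokernelIsCokernel t) }
  rw [← isZero_Q_obj_iff] at hK hL
  have hC : IsZero (DerivedCategory.Q.obj (cokernel g)) :=
    (Pretriangulated.Triangle.isZero₃_iff_isIso₁ _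
      (DerivedCategory.triangleOfSES_distinguished hg)).2 (hK.isIso hL _)
  have := isIso_cokernel_map_of_isPushout h
  rw [← DerivedCategory.isIso_Q_map_iff_quasiIso]
  exact (Pretriangulated.Triangle.isZero₃_iff_isIso₁ _
    (DerivedCategory.triangleOfSES_distinguished ht)).1
      (hC.of_iso (DerivedCategory.Q.mapIso (asIso (cokernel.map _ _ _ _ h.w))).symm)

lemma boundedComplex_pullback {K L M : CochainComplex A ℤ} (f : K ⟶ M) (g : L ⟶ M)
    (hK : boundedComplex A K) (hL : boundedComplex A L) (hM : boundedComplex A M) :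
    boundedComplex A (pullback f g) :=
  (boundedComplex A).prop_limit _ (by rintro (_ | _ | _) <;> assumption)

lemma boundedComplex_pushout {K L M : CochainComplex A ℤ} (f : M ⟶ K) (g : M ⟶ L)
    (hK : boundedComplex A K) (hL : boundedComplex A L) (hM : boundedComplex A M) :
    boundedComplex A (pushout f g) :=
  (boundedComplex A).prop_colimit _ (by rintro (_ | _ | _) <;> assumption)

/-- The morphism from `disk d i` determined by its component in degree `i`. -/
noncomputable def fromDisk {K : CochainComplex A ℤ} {d : A} {i : ℤ} (φ : d ⟶ K.X i) :
    disk d i ⟶ K :=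
  HomologicalComplex.mkHomFromDouble _ (by simp) φ (φ ≫ K.d i (i + 1)) (by simp) (by simp)

@[simp]
lemma fromDisk_f {K : CochainComplex A ℤ} {d : A} {i : ℤ} (φ : d ⟶ K.X i) :
    (fromDisk φ).f i = (diskIso₀ d i).hom ≫ φ :=
  HomologicalComplex.mkHomFromDouble_f₀ ..

@[simp]
lemma fromDisk_f_succ {K : CochainComplex A ℤ} {d : A} {i : ℤ} (φ : d ⟶ K.X i) :
    (fromDisk φ).f (i + 1) = (diskIso₁ d i).hom ≫ φ ≫ K.d i (i + 1) :=
  HomologicalComplex.mkHomFromDouble_f₁ ..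

/-- If `v : V ⟶ Xⁱ⁺¹` is an epimorphism, there is a quasi-isomorphism `X' ⟶ X` of bounded complexes
that factors through `v` in degree `i + 1`. The complex `X'` is the pullback of `X` along a morphism
of disks. -/
lemma exists_quasiIso_of_epi (X : Cb A) (i : ℤ) {V : A} (v : V ⟶ X.obj.X (i + 1)) [Epi v] :
    ∃ (X' : Cb A) (t : X' ⟶ X) (σ : X'.obj.X (i + 1) ⟶ V),
      QuasiIso t.hom ∧ σ ≫ v = t.hom.f (i + 1) := by
  let f : X.obj ⟶ disk (X.obj.X (i + 1)) i := toDisk (𝟙 _)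
  let g : disk V i ⟶ disk (X.obj.X (i + 1)) i := toDisk ((diskIso₁ V i).hom ≫ v)
  have : Epi g := by
    have (j : ℤ) : Epi (g.f j) := by
      by_cases h₀ : j = i
      · subst h₀
        dsimp only [g]
        rw [toDisk_f, disk_d]
        simp only [Category.assoc, Iso.inv_hom_id_assoc]
        infer_instance
      · by_cases h₁ : j = i + 1
        · subst h₁
          dsimp only [g]
          rw [toDisk_f_succ]
          infer_instance
        · exact ⟨fun _ _ _ => (HomologicalComplex.isZero_double_X _ _ _ h₀ h₁).eq_of_src _ _⟩
    exact HomologicalComplex.epi_of_epi_f _ this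
  refine ⟨⟨pullback f g, boundedComplex_pullback _ _ X.property (boundedComplex_disk _ _)
    (boundedComplex_disk _ _)⟩, ⟨pullback.fst f g⟩,
    (pullback.snd f g).f (i + 1) ≫ (diskIso₁ V i).hom,
    quasiIso_of_isPullback (IsPullback.of_hasPullback f g) (acyclic_disk _ _) (acyclic_disk _ _),
    ?_⟩
  have h := HomologicalComplex.congr_hom (pullback.condition (f := f) (g := g)) (i + 1)
  dsimp only [HomologicalComplex.comp_f] at h
  rw [← cancel_mono (diskIso₁ (X.obj.X (i + 1)) i).inv]
  simpa [f, g] using h.symm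

/-- The dual of `exists_quasiIso_of_epi`: the complex `X'` is a pushout along a morphism of
disks. -/
lemma exists_quasiIso_of_mono (X : Cb A) (i : ℤ) {V : A} (v : X.obj.X i ⟶ V) [Mono v] :
    ∃ (X' : Cb A) (t : X ⟶ X') (σ : V ⟶ X'.obj.X i),
      QuasiIso t.hom ∧ v ≫ σ = t.hom.f i := by
  let f : disk (X.obj.X i) i ⟶ X.obj := fromDisk (𝟙 _)
  let g : disk (X.obj.X i) i ⟶ disk V i := fromDisk (v ≫ (diskIso₀ V i).inv)
  have : Mono g := by
    have (j : ℤ) : Mono (g.f j) := by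
      by_cases h₀ : j = i
      · subst h₀
        dsimp only [g]
        rw [fromDisk_f]
        infer_instance
      · by_cases h₁ : j = i + 1
        · subst h₁
          dsimp only [g]
          rw [fromDisk_f_succ, disk_d]
          simp only [Category.assoc, Iso.inv_hom_id_assoc]
          infer_instance
        · exact ⟨fun _ _ _ => (HomologicalComplex.isZero_double_X _ _ _ h₀ h₁).eq_of_tgt _ _⟩
    exact HomologicalComplex.mono_of_mono_f _ this
  refine ⟨⟨pushout g f, boundedComplex_pushout _ _ (boundedComplex_disk _ _) X.property
    (boundedComplex_disk _ _)⟩, ⟨pushout.inr g f⟩,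
    (diskIso₀ V i).inv ≫ (pushout.inl g f).f i,
    quasiIso_of_isPushout (IsPushout.of_hasPushout g f) (acyclic_disk _ _) (acyclic_disk _ _),
    ?_⟩
  have h := HomologicalComplex.congr_hom (pushout.condition (f := g) (g := f)) i
  dsimp only [HomologicalComplex.comp_f] at h
  rw [← cancel_epi (diskIso₀ (X.obj.X i) i).hom]
  simpa [f, g] using h

end

/-! ### Morphisms to and from acyclic complexes -/

section

variable {A : Type u₁} [Category.{v} A] [Abelian A] {B : Type u₂} [Category.{v} B] [Abelian B]

/-- Every epimorphism onto an object `E.obj U` is dominated by the image of an epimorphism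
onto `U`. -/
def RefinesEpi (E : A ⥤ B) : Prop :=
  ∀ ⦃U : A⦄ ⦃Z : B⦄ (p : Z ⟶ E.obj U) [Epi p],
    ∃ (V : A) (v : V ⟶ U) (_ : Epi v) (h : E.obj V ⟶ Z), h ≫ p = E.map v

/-- Every monomorphism from an object `E.obj U` is dominated by the image of a monomorphism
from `U`. -/
def RefinesMono (E : A ⥤ B) : Prop :=
  ∀ ⦃U : A⦄ ⦃Z : B⦄ (p : E.obj U ⟶ Z) [Mono p],
    ∃ (V : A) (v : U ⟶ V) (_ : Mono v) (h : Z ⟶ E.obj V), p ≫ h = E.map v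

variable {E : A ⥤ B} [E.Additive]

omit [Abelian A] [E.Additive] in
/-- Exactness of `C`, tested on objects of `A`: a cycle of `C` over an object of `A` becomes a
boundary on an epimorphism of `A`. -/
lemma RefinesEpi.exists_lift (hE : RefinesEpi E) {C : CochainComplex B ℤ} {i : ℤ}
    (hC : C.ExactAt (i + 1)) {U : A} (x : E.obj U ⟶ C.X (i + 1))
    (hx : x ≫ C.d (i + 1) (i + 1 + 1) = 0) :
    ∃ (V : A) (v : V ⟶ U) (_ : Epi v) (z : E.obj V ⟶ C.X i),
      E.map v ≫ x = z ≫ C.d i (i + 1) := by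
  rw [C.exactAt_iff' i (i + 1) (i + 1 + 1) (by simp) (by simp),
    ShortComplex.exact_iff_exact_up_to_refinements] at hC
  obtain ⟨W, π, hπ, z, hz⟩ := hC x hx
  obtain ⟨V, v, hv, h, fac⟩ := hE π
  refine ⟨V, v, hv, h ≫ z, ?_⟩
  rw [← fac, Category.assoc]
  exact (congrArg (h ≫ ·) hz).trans (Category.assoc _ _ _).symm

omit [Abelian A] [E.Additive] in
/-- The dual of `RefinesEpi.exists_lift`. -/
lemma RefinesMono.exists_desc (hE : RefinesMono E) {C : CochainComplex B ℤ} {i : ℤ}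
    (hC : C.ExactAt (i + 1)) {U : A} (x : C.X (i + 1) ⟶ E.obj U)
    (hx : C.d i (i + 1) ≫ x = 0) :
    ∃ (V : A) (v : U ⟶ V) (_ : Mono v) (z : C.X (i + 1 + 1) ⟶ E.obj V),
      x ≫ E.map v = C.d (i + 1) (i + 1 + 1) ≫ z := by
  rw [C.exactAt_iff' i (i + 1) (i + 1 + 1) (by simp) (by simp), ← ShortComplex.exact_op_iff,
    ShortComplex.exact_iff_exact_up_to_refinements] at hC
  obtain ⟨W, π, hπ, z, hz⟩ := hC x.op (congrArg Quiver.Hom.op hx)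
  let π' : E.obj U ⟶ W.unop := π.unop
  have : Mono π' := unop_mono_of_epi π
  obtain ⟨V, v, hv, h, fac⟩ := hE π'
  refine ⟨V, v, hv, z.unop ≫ h, ?_⟩
  rw [← fac, ← Category.assoc]
  exact (congrArg (· ≫ h) (congrArg Quiver.Hom.unop hz)).trans (Category.assoc _ _ _)

/-- A morphism to an acyclic complex that vanishes in degrees above `i + 1` may be replaced by one
that vanishes in degrees above `i`, up to a quasi-isomorphism in `A` and a homotopy whose single
component expresses the component of degree `i + 1` as a boundary. -/
lemma RefinesEpi.exists_homotopy_step (hE : RefinesEpi E) (X : Cb A) {C : CochainComplex B ℤ}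
    (hC : C.Acyclic) (y : ((mapCb E).obj X).obj ⟶ C) (i : ℤ) (hy : ∀ j, i + 1 < j → y.f j = 0) :
    ∃ (X' : Cb A) (t : X' ⟶ X) (y' : ((mapCb E).obj X').obj ⟶ C), QuasiIso t.hom ∧
      Nonempty (Homotopy (((mapCb E).map t).hom ≫ y) y') ∧ ∀ j, i < j → y'.f j = 0 := by
  let x (j : ℤ) : E.obj (X.obj.X j) ⟶ C.X j := y.f j
  obtain ⟨V, v, _, z, hz⟩ := hE.exists_lift (hC (i + 1)) (x (i + 1))
    ((y.comm (i + 1) (i + 1 + 1)).trans ((congrArg (_ ≫ ·) (hy _ (by lia))).trans comp_zero))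
  obtain ⟨X', t, σ, ht, hσ⟩ := exists_quasiIso_of_epi X i v
  obtain ⟨φ, ⟨hφ⟩, -, h₁, h₂⟩ := exists_nullHomotopic_of_component
    (K := ((mapCb E).obj X').obj) (L := C) i (E.map σ ≫ z)
  refine ⟨X', t, ((mapCb E).map t).hom ≫ y - φ, ht,
    ⟨Homotopy.equivSubZero.symm ((Homotopy.ofEq (sub_sub_cancel _ _)).trans hφ)⟩, ?_⟩
  intro j hj
  rw [HomologicalComplex.sub_f_apply, sub_eq_zero, HomologicalComplex.comp_f]
  by_cases hj' : j = i + 1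
  · subst hj'
    have e : E.map (t.hom.f (i + 1)) ≫ x (i + 1) = (E.map σ ≫ z) ≫ C.d i (i + 1) := by
      rw [← hσ, E.map_comp, Category.assoc, hz, Category.assoc]
    exact e.trans h₁.symm
  · rw [h₂ j (by lia) hj', hy j (by lia), comp_zero]

/-- The dual of `RefinesEpi.exists_homotopy_step`. -/
lemma RefinesMono.exists_homotopy_step (hE : RefinesMono E) (X : Cb A) {C : CochainComplex B ℤ}
    (hC : C.Acyclic) (y : C ⟶ ((mapCb E).obj X).obj) (i : ℤ) (hy : ∀ j, j < i + 1 → y.f j = 0) :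
    ∃ (X' : Cb A) (t : X ⟶ X') (y' : C ⟶ ((mapCb E).obj X').obj), QuasiIso t.hom ∧
      Nonempty (Homotopy (y ≫ ((mapCb E).map t).hom) y') ∧ ∀ j, j < i + 1 + 1 → y'.f j = 0 := by
  let x (j : ℤ) : C.X j ⟶ E.obj (X.obj.X j) := y.f j
  obtain ⟨V, v, _, z, hz⟩ := hE.exists_desc (hC (i + 1)) (x (i + 1))
    ((y.comm i (i + 1)).symm.trans ((congrArg (· ≫ _) (hy _ (by lia))).trans zero_comp))
  obtain ⟨X', t, σ, ht, hσ⟩ := exists_quasiIso_of_mono X (i + 1) v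
  obtain ⟨φ, ⟨hφ⟩, h₁, -, h₂⟩ := exists_nullHomotopic_of_component
    (K := C) (L := ((mapCb E).obj X').obj) (i + 1) (z ≫ E.map σ)
  refine ⟨X', t, y ≫ ((mapCb E).map t).hom - φ, ht,
    ⟨Homotopy.equivSubZero.symm ((Homotopy.ofEq (sub_sub_cancel _ _)).trans hφ)⟩, ?_⟩
  intro j hj
  rw [HomologicalComplex.sub_f_apply, sub_eq_zero, HomologicalComplex.comp_f]
  by_cases hj' : j = i + 1
  · subst hj'
    have e : x (i + 1) ≫ E.map (t.hom.f (i + 1)) = C.d (i + 1) (i + 1 + 1) ≫ z ≫ E.map σ := by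
      rw [← hσ, E.map_comp, ← Category.assoc, hz, Category.assoc]
    exact e.trans h₁.symm
  · rw [h₂ j hj' (by lia), hy j (by lia), zero_comp]

/-- A morphism from a bounded complex of `A` to an acyclic bounded below complex of `B` becomes
null-homotopic after a quasi-isomorphism in `A`. The induction is on the top degree in which `y`
does not vanish; it ends because `C` is bounded below. -/
lemma RefinesEpi.exists_homotopy_zero (hE : RefinesEpi E) (X : Cb A) {C : CochainComplex B ℤ}
    (hC : C.Acyclic) (c : ℤ) [C.IsStrictlyGE c] (y : ((mapCb E).obj X).obj ⟶ C) :
    ∃ (X' : Cb A) (t : X' ⟶ X), QuasiIso t.hom ∧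
      Nonempty (Homotopy (((mapCb E).map t).hom ≫ y) 0) := by
  have key : ∀ (n : ℕ) (X : Cb A) (y : ((mapCb E).obj X).obj ⟶ C),
      (∀ j, c + n ≤ j → y.f j = 0) → ∃ (X' : Cb A) (t : X' ⟶ X), QuasiIso t.hom ∧
        Nonempty (Homotopy (((mapCb E).map t).hom ≫ y) 0) := by
    intro n
    induction n with
    | zero =>
      intro X y hy
      obtain rfl : y = 0 := by
        ext j
        by_cases hj : c ≤ j
        · exact hy j (by simpa using hj)
        · exact (C.isZero_of_isStrictlyGE c j (by lia)).eq_of_tgt _ _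
      exact ⟨X, 𝟙 X, inferInstanceAs (QuasiIso (𝟙 X.obj)), ⟨Homotopy.ofEq comp_zero⟩⟩
    | succ n hn =>
      intro X y hy
      obtain ⟨X₁, t₁, y₁, ht₁, ⟨h₁⟩, hy₁⟩ :=
        hE.exists_homotopy_step X hC y (c + n - 1) (fun j hj => hy j (by push_cast; lia))
      obtain ⟨X₂, t₂, ht₂, ⟨h₂⟩⟩ := hn X₁ y₁ (fun j hj => hy₁ j (by lia))
      refine ⟨X₂, t₂ ≫ t₁, inferInstanceAs (QuasiIso (t₂.hom ≫ t₁.hom)),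
        ⟨(Homotopy.ofEq ?_).trans ((h₁.compLeft ((mapCb E).map t₂).hom).trans h₂)⟩⟩
      rw [Functor.map_comp, ObjectProperty.FullSubcategory.comp_hom, Category.assoc]
  obtain ⟨a, b, ha, hb⟩ := ((mapCb E).obj X).property
  refine key (b + 1 - c).toNat X y (fun j hj => ?_)
  exact (((mapCb E).obj X).obj.isZero_of_isStrictlyLE b j (by lia)).eq_of_src _ _

/-- The dual of `RefinesEpi.exists_homotopy_zero`, by ascending induction on degrees. -/
lemma RefinesMono.exists_homotopy_zero (hE : RefinesMono E) (X : Cb A) {C : CochainComplex B ℤ}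
    (hC : C.Acyclic) (c : ℤ) [C.IsStrictlyLE c] (y : C ⟶ ((mapCb E).obj X).obj) :
    ∃ (X' : Cb A) (t : X ⟶ X'), QuasiIso t.hom ∧
      Nonempty (Homotopy (y ≫ ((mapCb E).map t).hom) 0) := by
  have key : ∀ (n : ℕ) (X : Cb A) (y : C ⟶ ((mapCb E).obj X).obj),
      (∀ j, j ≤ c - n → y.f j = 0) → ∃ (X' : Cb A) (t : X ⟶ X'), QuasiIso t.hom ∧
        Nonempty (Homotopy (y ≫ ((mapCb E).map t).hom) 0) := by
    intro n
    induction n with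
    | zero =>
      intro X y hy
      obtain rfl : y = 0 := by
        ext j
        by_cases hj : j ≤ c
        · exact hy j (by simpa using hj)
        · exact (C.isZero_of_isStrictlyLE c j (by lia)).eq_of_src _ _
      exact ⟨X, 𝟙 X, inferInstanceAs (QuasiIso (𝟙 X.obj)), ⟨Homotopy.ofEq zero_comp⟩⟩
    | succ n hn =>
      intro X y hy
      obtain ⟨X₁, t₁, y₁, ht₁, ⟨h₁⟩, hy₁⟩ :=
        hE.exists_homotopy_step X hC y (c - n - 1) (fun j hj => hy j (by push_cast; lia))
      obtain ⟨X₂, t₂, ht₂, ⟨h₂⟩⟩ := hn X₁ y₁ (fun j hj => hy₁ j (by lia))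
      refine ⟨X₂, t₁ ≫ t₂, inferInstanceAs (QuasiIso (t₁.hom ≫ t₂.hom)),
        ⟨(Homotopy.ofEq ?_).trans ((h₁.compRight ((mapCb E).map t₂).hom).trans h₂)⟩⟩
      rw [Functor.map_comp, ObjectProperty.FullSubcategory.comp_hom, Category.assoc]
  obtain ⟨a, b, ha, hb⟩ := ((mapCb E).obj X).property
  refine key (c + 1 - a).toNat X y (fun j hj => ?_)
  exact (((mapCb E).obj X).obj.isZero_of_isStrictlyGE a j (by lia)).eq_of_tgt _ _

end

/-! ### Fractions with denominators in `A` -/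

section

open CochainComplex HomComplex

variable {B : Type u} [Category.{v} B] [Abelian B]

lemma acyclic_mappingCone {K L : CochainComplex B ℤ} (s : K ⟶ L) [QuasiIso s] :
    HomologicalComplex.Acyclic (mappingCone s) := by
  let := HasDerivedCategory.standard B
  rw [← isZero_Q_obj_iff]
  refine (Pretriangulated.Triangle.isZero₃_iff_isIso₁ _
    (DerivedCategory.mappingCone_triangle_distinguished s)).2 ?_
  exact inferInstanceAs (IsIso (DerivedCategory.Q.map s))

lemma acyclic_mappingCocone {K L : CochainComplex B ℤ} (s : K ⟶ L) [QuasiIso s] :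
    HomologicalComplex.Acyclic (mappingCocone s) := by
  let := HasDerivedCategory.standard B
  rw [← isZero_Q_obj_iff]
  refine (Pretriangulated.Triangle.isZero₁_iff_isIso₂ _
    (DerivedCategory.mappingCocone_triangle_distinguished s)).2 ?_
  exact inferInstanceAs (IsIso (DerivedCategory.Q.map s))

lemma isStrictlyLE_mappingCone {K L : CochainComplex B ℤ} (s : K ⟶ L) (n : ℤ)
    [K.IsStrictlyLE n] [L.IsStrictlyLE n] : (mappingCone s).IsStrictlyLE n := by
  rw [isStrictlyLE_iff]
  intro i hi
  rw [mappingCone.isZero_X_iff]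
  exact ⟨K.isZero_of_isStrictlyLE n _, L.isZero_of_isStrictlyLE n _⟩

lemma homotopyCategory_mappingCocone_distinguished {K L : CochainComplex B ℤ} (s : K ⟶ L) :
    (HomotopyCategory.quotient B (.up ℤ)).mapTriangle.obj (mappingCocone.triangle s) ∈
      Pretriangulated.distinguishedTriangles := by
  rw [Pretriangulated.rotate_distinguished_triangle]
  have hs : mappingCone.triangleh s ∈ Pretriangulated.distinguishedTriangles :=
    ⟨_, _, s, ⟨Iso.refl _⟩⟩
  exact Pretriangulated.isomorphic_distinguished _ hs _
    ((HomotopyCategory.quotient _ _).mapTriangleRotateIso.app _ ≪≫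
    (HomotopyCategory.quotient _ _).mapTriangle.mapIso (mappingCocone.rotateTriangleIso s))

lemma exists_lift_of_comp_inr {K L M : CochainComplex B ℤ} (s : K ⟶ L) (f : M ⟶ L)
    (h : Homotopy (f ≫ mappingCone.inr s) 0) : ∃ g : M ⟶ K, Nonempty (Homotopy (g ≫ s) f) := by
  have hT : mappingCone.triangleh s ∈ Pretriangulated.distinguishedTriangles :=
    ⟨_, _, s, ⟨Iso.refl _⟩⟩
  obtain ⟨g, hg⟩ := Pretriangulated.Triangle.coyoneda_exact₂ _ hT
    ((HomotopyCategory.quotient _ _).map f)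
    (((HomotopyCategory.quotient _ _).map_comp f (mappingCone.inr s)).symm.trans
      ((HomotopyCategory.eq_of_homotopy _ _ h).trans (Functor.map_zero _ _ _)))
  obtain ⟨g, rfl⟩ := (HomotopyCategory.quotient _ _).map_surjective g
  refine ⟨g, ⟨HomotopyCategory.homotopyOfEq _ _ ?_⟩⟩
  exact (Functor.map_comp _ _ _).trans hg.symm

lemma exists_desc_of_fst_comp {K L M : CochainComplex B ℤ} (s : K ⟶ L) (f : K ⟶ M)
    (h : Homotopy (mappingCocone.fst s ≫ f) 0) :
    ∃ g : L ⟶ M, Nonempty (Homotopy (s ≫ g) f) := by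
  obtain ⟨g, hg⟩ := Pretriangulated.Triangle.yoneda_exact₂ _
    (homotopyCategory_mappingCocone_distinguished s) ((HomotopyCategory.quotient _ _).map f)
    (((HomotopyCategory.quotient _ _).map_comp (mappingCocone.fst s) f).symm.trans
      ((HomotopyCategory.eq_of_homotopy _ _ h).trans (Functor.map_zero _ _ _)))
  obtain ⟨g, rfl⟩ := (HomotopyCategory.quotient _ _).map_surjective g
  refine ⟨g, ⟨HomotopyCategory.homotopyOfEq _ _ ?_⟩⟩
  exact (Functor.map_comp _ _ _).trans hg.symm

variable [HasDerivedCategory.{w} B]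

/-- The truncation of the quasi-isomorphism given by the calculus of fractions keeps the bound of
`L`. -/
lemma exists_homotopy_comp_of_Q_map_eq_zero {K L : CochainComplex B ℤ} (f : K ⟶ L)
    (hf : DerivedCategory.Q.map f = 0) (n : ℤ) [L.IsStrictlyGE n] :
    ∃ (M : CochainComplex B ℤ) (_ : M.IsStrictlyGE n) (s : L ⟶ M),
      QuasiIso s ∧ Nonempty (Homotopy (f ≫ s) 0) := by
  have h : DerivedCategory.Qh.map ((HomotopyCategory.quotient _ _).map f) =
      DerivedCategory.Qh.map ((HomotopyCategory.quotient _ _).map 0) := by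
    rw [← cancel_mono ((DerivedCategory.quotientCompQhIso B).hom.app L)]
    simp [hf]
  obtain ⟨M, s, hs, fac⟩ := (MorphismProperty.map_eq_iff_postcomp DerivedCategory.Qh
    (HomotopyCategory.quasiIso B (.up ℤ)) _ _).1 h
  obtain ⟨M, rfl⟩ := HomotopyCategory.quotient_obj_surjective M
  obtain ⟨s, rfl⟩ := (HomotopyCategory.quotient _ _).map_surjective s
  rw [HomotopyCategory.quotient_map_mem_quasiIso_iff, HomologicalComplex.mem_quasiIso_iff] at hs
  have hs' : QuasiIso (s ≫ CochainComplex.πTruncGE M n) := by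
    have : QuasiIso (truncGEMap s n) := by
      rw [quasiIso_truncGEMap_iff]
      infer_instance
    rw [← πTruncGE_naturality]
    infer_instance
  have h₀ : Homotopy (f ≫ s) 0 := HomotopyCategory.homotopyOfEq _ _
    ((Functor.map_comp _ _ _).trans (fac.trans (by simp)))
  exact ⟨CochainComplex.truncGE M n, inferInstance, s ≫ CochainComplex.πTruncGE M n, hs',
    ⟨(Homotopy.ofEq (Category.assoc _ _ _).symm).trans
      ((h₀.compRight (CochainComplex.πTruncGE M n)).trans (Homotopy.ofEq zero_comp))⟩⟩

/-- The dual of `exists_homotopy_comp_of_Q_map_eq_zero`. -/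
lemma exists_comp_homotopy_of_Q_map_eq_zero {K L : CochainComplex B ℤ} (f : K ⟶ L)
    (hf : DerivedCategory.Q.map f = 0) (n : ℤ) [K.IsStrictlyLE n] :
    ∃ (M : CochainComplex B ℤ) (_ : M.IsStrictlyLE n) (s : M ⟶ K),
      QuasiIso s ∧ Nonempty (Homotopy (s ≫ f) 0) := by
  have h : DerivedCategory.Qh.map ((HomotopyCategory.quotient _ _).map f) =
      DerivedCategory.Qh.map ((HomotopyCategory.quotient _ _).map 0) := by
    rw [← cancel_mono ((DerivedCategory.quotientCompQhIso B).hom.app L)]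
    simp [hf]
  obtain ⟨M, s, hs, fac⟩ := (MorphismProperty.map_eq_iff_precomp DerivedCategory.Qh
    (HomotopyCategory.quasiIso B (.up ℤ)) _ _).1 h
  obtain ⟨M, rfl⟩ := HomotopyCategory.quotient_obj_surjective M
  obtain ⟨s, rfl⟩ := (HomotopyCategory.quotient _ _).map_surjective s
  rw [HomotopyCategory.quotient_map_mem_quasiIso_iff, HomologicalComplex.mem_quasiIso_iff] at hs
  have hs' : QuasiIso (CochainComplex.ιTruncLE M n ≫ s) := by
    have : QuasiIso (truncLEMap s n) := by
      rw [quasiIso_truncLEMap_iff]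
      infer_instance
    rw [← ιTruncLE_naturality]
    infer_instance
  have h₀ : Homotopy (s ≫ f) 0 := HomotopyCategory.homotopyOfEq _ _
    ((Functor.map_comp _ _ _).trans (fac.trans (by simp)))
  exact ⟨CochainComplex.truncLE M n, inferInstance, CochainComplex.ιTruncLE M n ≫ s, hs',
    ⟨(Homotopy.ofEq (Category.assoc _ _ _)).trans
      ((h₀.compLeft (CochainComplex.ιTruncLE M n)).trans (Homotopy.ofEq comp_zero))⟩⟩

end

section

open CochainComplex HomComplex

variable {A : Type u₁} [Category.{v} A] [Abelian A] {B : Type u₂} [Category.{v} B] [Abelian B]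
  [HasDerivedCategory.{w} B] {E : A ⥤ B} [E.Additive]

/-- A morphism `Q(E(X)) ⟶ Q(Z)` is a fraction `s⁻¹ f` with `s : Z ⟶ Z₁`. The composite of `f` with
`Z₁ ⟶ cone(s)` becomes null-homotopic on some `X'`, and there `f` lifts to `Z`. -/
lemma RefinesEpi.exists_right_fac (hE : RefinesEpi E) (X : Cb A) (Z : Cb B)
    (φ : DerivedCategory.Q.obj ((mapCb E).obj X).obj ⟶ DerivedCategory.Q.obj Z.obj) :
    ∃ (X' : Cb A) (t : X' ⟶ X) (y : (mapCb E).obj X' ⟶ Z), QuasiIso t.hom ∧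
      DerivedCategory.Q.map ((mapCb E).map t).hom ≫ φ = DerivedCategory.Q.map y.hom := by
  obtain ⟨a, b, ha, hb⟩ := Z.property
  obtain ⟨Z₁, _, f, s, hs, rfl⟩ := DerivedCategory.left_fac_of_isStrictlyGE φ a
  have hs' := (DerivedCategory.isIso_Q_map_iff_quasiIso _ s).1 hs
  have := isStrictlyGE_mappingCone s a a (a - 1)
  obtain ⟨X', t, ht, ⟨h⟩⟩ := hE.exists_homotopy_zero X (acyclic_mappingCone s) (a - 1)
    (f ≫ mappingCone.inr s)
  obtain ⟨g, ⟨hg⟩⟩ := exists_lift_of_comp_inr s (((mapCb E).map t).hom ≫ f)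
    ((Homotopy.ofEq (Category.assoc _ _ _)).trans h)
  refine ⟨X', t, ⟨g⟩, ht, ?_⟩
  rw [← cancel_mono (DerivedCategory.Q.map s), Category.assoc, Category.assoc,
    IsIso.inv_hom_id, Category.comp_id, ← Functor.map_comp, ← Functor.map_comp]
  exact (DerivedCategory.Q_map_eq_of_homotopy B hg).symm

/-- The dual of `RefinesEpi.exists_right_fac`, with the cocone of a denominator. -/
lemma RefinesMono.exists_left_fac (hE : RefinesMono E) (X : Cb A) (Z : Cb B)
    (φ : DerivedCategory.Q.obj Z.obj ⟶ DerivedCategory.Q.obj ((mapCb E).obj X).obj) :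
    ∃ (X' : Cb A) (t : X ⟶ X') (y : Z ⟶ (mapCb E).obj X'), QuasiIso t.hom ∧
      φ ≫ DerivedCategory.Q.map ((mapCb E).map t).hom = DerivedCategory.Q.map y.hom := by
  obtain ⟨a, b, ha, hb⟩ := Z.property
  obtain ⟨Z₁, _, s, hs, f, rfl⟩ := DerivedCategory.right_fac_of_isStrictlyLE φ b
  have hs' := (DerivedCategory.isIso_Q_map_iff_quasiIso _ s).1 hs
  have := isStrictlyLE_mappingCone s b
  have : (mappingCocone s).IsStrictlyLE (b + 1) :=
    (mappingCone s).isStrictlyLE_shift b (-1) (b + 1) (by lia)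
  obtain ⟨X', t, ht, ⟨h⟩⟩ := hE.exists_homotopy_zero X (acyclic_mappingCocone s) (b + 1)
    (mappingCocone.fst s ≫ f)
  obtain ⟨g, ⟨hg⟩⟩ := exists_desc_of_fst_comp s (f ≫ ((mapCb E).map t).hom)
    ((Homotopy.ofEq (Category.assoc _ _ _).symm).trans h)
  refine ⟨X', t, ⟨g⟩, ht, ?_⟩
  rw [← cancel_epi (DerivedCategory.Q.map s), Category.assoc,
    IsIso.hom_inv_id_assoc, ← Functor.map_comp, ← Functor.map_comp]
  exact (DerivedCategory.Q_map_eq_of_homotopy B hg).symm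

/-- If `y` vanishes in the derived category, then `y ≫ s` is null-homotopic for a quasi-isomorphism
`s`, and a null-homotopy is a lift of `y` to the acyclic cocone of `s`. -/
lemma RefinesEpi.exists_homotopy_of_Q_map_eq_zero (hE : RefinesEpi E) {X : Cb A} {Z : Cb B}
    (y : (mapCb E).obj X ⟶ Z) (hy : DerivedCategory.Q.map y.hom = 0) :
    ∃ (X' : Cb A) (t : X' ⟶ X), QuasiIso t.hom ∧
      Nonempty (Homotopy ((mapCb E).map t ≫ y).hom 0) := by
  obtain ⟨a, b, ha, hb⟩ := Z.property
  obtain ⟨M, _, s, hs, ⟨h⟩⟩ := exists_homotopy_comp_of_Q_map_eq_zero y.hom hy a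
  have := isStrictlyGE_mappingCone s a a (a - 1)
  have : (mappingCocone s).IsStrictlyGE a :=
    (mappingCone s).isStrictlyGE_shift (a - 1) (-1) a (by lia)
  obtain ⟨X', t, ht, ⟨h⟩⟩ := hE.exists_homotopy_zero X (acyclic_mappingCocone s) a
    (mappingCocone.lift s y.hom (-Cochain.ofHomotopy h) (by simp))
  refine ⟨X', t, ht, ⟨(Homotopy.ofEq ?_).trans ((h.compRight (mappingCocone.fst s)).trans
    (Homotopy.ofEq zero_comp))⟩⟩
  rw [Category.assoc, mappingCocone.lift_fst, ObjectProperty.FullSubcategory.comp_hom]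

/-- The dual of `RefinesEpi.exists_homotopy_of_Q_map_eq_zero`. -/
lemma RefinesMono.exists_homotopy_of_Q_map_eq_zero (hE : RefinesMono E) {X : Cb A} {Z : Cb B}
    (y : Z ⟶ (mapCb E).obj X) (hy : DerivedCategory.Q.map y.hom = 0) :
    ∃ (X' : Cb A) (t : X ⟶ X'), QuasiIso t.hom ∧
      Nonempty (Homotopy (y ≫ (mapCb E).map t).hom 0) := by
  obtain ⟨a, b, ha, hb⟩ := Z.property
  obtain ⟨M, _, s, hs, ⟨h⟩⟩ := exists_comp_homotopy_of_Q_map_eq_zero y.hom hy b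
  have := isStrictlyLE_mappingCone s b
  obtain ⟨X', t, ht, ⟨h⟩⟩ := hE.exists_homotopy_zero X (acyclic_mappingCone s) b
    (mappingCone.desc s (Cochain.ofHomotopy h) y.hom (by simp))
  refine ⟨X', t, ht, ⟨(Homotopy.ofEq ?_).trans ((h.compLeft (mappingCone.inr s)).trans
    (Homotopy.ofEq comp_zero))⟩⟩
  rw [← Category.assoc, mappingCone.inr_desc, ObjectProperty.FullSubcategory.comp_hom]

end

/-! ### Morphisms from objects of `C` to ind-objects -/

section

variable {C : Type u} [Category.{v} C]

/-- The Yoneda lemma for ind-objects. -/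
noncomputable def indYonedaHomEquiv (U : C) (W : Ind C) :
    (Ind.yoneda.obj U ⟶ W) ≃ ((Ind.inclusion C).obj W).obj (op U) :=
  Ind.inclusion.fullyFaithful.homEquiv.trans
    ((Ind.yonedaCompInclusion.app U).homFromEquiv.trans yonedaEquiv)

lemma indYonedaHomEquiv_comp {U : C} {W W' : Ind C} (f : Ind.yoneda.obj U ⟶ W) (g : W ⟶ W') :
    indYonedaHomEquiv U W' (f ≫ g) =
      ((Ind.inclusion C).map g).app (op U) (indYonedaHomEquiv U W f) := by
  change yonedaEquiv (Ind.yonedaCompInclusion.inv.app U ≫ (Ind.inclusion C).map (f ≫ g)) = _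
  rw [Functor.map_comp, ← Category.assoc, yonedaEquiv_comp]
  rfl

lemma indYonedaHomEquiv_map_comp {U U' : C} {W : Ind C} (u : U' ⟶ U) (f : Ind.yoneda.obj U ⟶ W) :
    indYonedaHomEquiv U' W (Ind.yoneda.map u ≫ f) =
      ((Ind.inclusion C).obj W).map u.op (indYonedaHomEquiv U W f) := by
  have h := Ind.yonedaCompInclusion.inv.naturality u
  have h' := yonedaEquiv_naturality
    (Ind.yonedaCompInclusion.inv.app U ≫ (Ind.inclusion C).map f) u
  refine Eq.trans (congr_arg yonedaEquiv ?_) h'.symm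
  change Ind.yonedaCompInclusion.inv.app U' ≫ (Ind.inclusion C).map (Ind.yoneda.map u ≫ f) = _
  rw [Functor.map_comp]
  exact (reassoc_of% h) _ |>.symm

/-- The functor that `U` corepresents on `Ind(C)` is the evaluation of presheaves at `U`. -/
noncomputable def coyonedaIndYonedaIso (U : C) :
    coyoneda.obj (op (Ind.yoneda.obj U)) ≅ Ind.inclusion C ⋙ (evaluation _ _).obj (op U) :=
  NatIso.ofComponents (fun W => (indYonedaHomEquiv U W).toIso) (fun g => by
    ext f
    exact indYonedaHomEquiv_comp f g)

instance {I : Type v} [SmallCategory I] [IsFiltered I] (U : C) :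
    PreservesColimitsOfShape I (coyoneda.obj (op (Ind.yoneda.obj U))) :=
  preservesColimitsOfShape_of_natIso (coyonedaIndYonedaIso U).symm

variable {I : Type v} [SmallCategory I] [IsFiltered I]

/-- The canonical morphism from a term of a filtered system to the ind-object it defines. -/
noncomputable def indLimι (G : I ⥤ C) (i : I) : Ind.yoneda.obj (G.obj i) ⟶ (Ind.lim I).obj G :=
  colimit.ι (G ⋙ Ind.yoneda) i

lemma indLimι_map {F G : I ⥤ C} (φ : F ⟶ G) (i : I) :
    indLimι F i ≫ (Ind.lim I).map φ = Ind.yoneda.map (φ.app i) ≫ indLimι G i :=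
  ι_colimMap _ _

lemma indLimι_w (G : I ⥤ C) {i j : I} (f : i ⟶ j) :
    Ind.yoneda.map (G.map f) ≫ indLimι G j = indLimι G i :=
  colimit.w (G ⋙ Ind.yoneda) f

lemma exists_map_comp_indLimι {U : C} {G : I ⥤ C} (f : Ind.yoneda.obj U ⟶ (Ind.lim I).obj G) :
    ∃ (i : I) (g : U ⟶ G.obj i), Ind.yoneda.map g ≫ indLimι G i = f := by
  obtain ⟨i, g, hg⟩ := Types.jointly_surjective _
    (isColimitOfPreserves (coyoneda.obj (op (Ind.yoneda.obj U)))
      (colimit.isColimit (G ⋙ Ind.yoneda))) f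
  obtain ⟨g, rfl⟩ := Ind.yoneda.map_surjective g
  exact ⟨i, g, hg⟩

lemma exists_map_eq_of_map_comp_indLimι_eq {U : C} {G : I ⥤ C} {i : I} (g g' : U ⟶ G.obj i)
    (h : Ind.yoneda.map g ≫ indLimι G i = Ind.yoneda.map g' ≫ indLimι G i) :
    ∃ (j : I) (f : i ⟶ j), g ≫ G.map f = g' ≫ G.map f := by
  obtain ⟨j, f, hf⟩ := (Types.FilteredColimit.isColimit_eq_iff'
    (isColimitOfPreserves (coyoneda.obj (op (Ind.yoneda.obj U)))
      (colimit.isColimit (G ⋙ Ind.yoneda))) (Ind.yoneda.map g) (Ind.yoneda.map g')).1 h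
  refine ⟨j, f, Ind.yoneda.map_injective ?_⟩
  rw [Functor.map_comp, Functor.map_comp]
  exact hf

end

/-! ### Refinement of epimorphisms and generation by `A` -/

section

variable {A : Type u} [Category.{v} A] [Abelian A]

/-- An epimorphism from an ind-object to an object `U` of `A` is represented by a morphism `φ` of
filtered systems. The cokernel of `φ` defines the zero ind-object, hence some stage of `φ` covers
`U`. -/
lemma refinesEpi_indYoneda : RefinesEpi (Ind.yoneda (C := A)) := by
  intro U Z p _
  obtain ⟨I, _, _, F, G, φ, ⟨e⟩⟩ := Ind.exists_nonempty_arrow_mk_iso_ind_lim (f := p)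
  have he : p ≫ e.hom.right = e.hom.left ≫ (Ind.lim I).map φ := e.hom.w.symm
  have : Epi ((Ind.lim I).map φ) := by
    have : Epi (e.hom.left ≫ (Ind.lim I).map φ) := he ▸ epi_comp p e.hom.right
    exact epi_of_epi e.hom.left _
  have hπ : (Ind.lim I).map (cokernel.π φ) = (Ind.lim I).map 0 := by
    rw [← cancel_epi ((Ind.lim I).map φ), ← Functor.map_comp, ← Functor.map_comp,
      cokernel.condition, comp_zero]
  obtain ⟨i, g, hg⟩ := exists_map_comp_indLimι e.hom.right
  obtain ⟨j, f, hf⟩ := exists_map_eq_of_map_comp_indLimι_eq (G := cokernel φ)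
    (g ≫ (cokernel.π φ).app i) (g ≫ (0 : G ⟶ cokernel φ).app i) (by
      rw [Functor.map_comp, Functor.map_comp, Category.assoc, Category.assoc,
        ← indLimι_map, ← indLimι_map, hπ])
  -- The element `g` of the system of `U` dies in the cokernel of `φ` at the stage `j`, so that it
  -- comes from `F` at this stage on an epimorphism `v : V ⟶ U`.
  have hex : (ShortComplex.mk (φ.app j) ((cokernel.π φ).app j)
      (by rw [← NatTrans.comp_app, cokernel.condition]; rfl)).Exact := by
    have := (ShortComplex.exact_of_g_is_cokernel (ShortComplex.mk _ _ (cokernel.condition φ))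
      (cokernelIsCokernel φ)).map ((evaluation I A).obj j)
    exact this
  rw [ShortComplex.exact_iff_exact_up_to_refinements] at hex
  obtain ⟨V, v, hv, z, hz⟩ := hex (g ≫ G.map f) (by
    have := (cokernel.π φ).naturality f
    dsimp at this ⊢
    rw [Category.assoc, this, ← Category.assoc, hf]
    simp)
  refine ⟨V, v, hv, Ind.yoneda.map z ≫ indLimι F j ≫ e.inv.left, ?_⟩
  have he' : e.inv.left ≫ p = (Ind.lim I).map φ ≫ e.inv.right := e.inv.w
  dsimp at hz
  rw [Category.assoc, Category.assoc, he', reassoc_of% (indLimι_map φ), ← Category.assoc,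
    ← Functor.map_comp, ← hz, Functor.map_comp, Functor.map_comp, Category.assoc, Category.assoc,
    reassoc_of% (indLimι_w G f), reassoc_of% hg]
  have : e.hom.right ≫ e.inv.right = 𝟙 _ := Arrow.hom_inv_id_right e
  rw [this]
  exact Category.comp_id _

lemma refinesMono_proYoneda : RefinesMono (proYoneda (C := A)) := by
  intro U Z p _
  obtain ⟨V, v, _, h, fac⟩ := refinesEpi_indYoneda (A := Aᵒᵖ) (U := op U) p.unop
  exact ⟨V.unop, v.unop, inferInstance, h.op, congr_arg Quiver.Hom.op fac⟩

lemma eq_zero_of_indYoneda_comp {M N : Ind A} (f : M ⟶ N)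
    (hf : ∀ (U : A) (g : Ind.yoneda.obj U ⟶ M), g ≫ f = 0) : f = 0 := by
  rw [← cancel_epi (Ind.colimitPresentationCompYoneda M).hom]
  refine colimit.hom_ext (fun j => ?_)
  rw [← Category.assoc]
  exact (hf _ _).trans (by simp)

lemma eq_zero_of_comp_proYoneda {M N : Pro A} (f : M ⟶ N)
    (hf : ∀ (U : A) (g : N ⟶ proYoneda.obj U), f ≫ g = 0) : f = 0 :=
  Quiver.Hom.unop_inj (eq_zero_of_indYoneda_comp f.unop
    (fun U g => congr_arg Quiver.Hom.unop (hf U.unop g.op)))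

instance : PreservesFiniteLimits (proYoneda (C := A)) := preservesFiniteLimits_rightOp _

instance : PreservesFiniteColimits (proYoneda (C := A)) := preservesFiniteColimits_rightOp _

end

/-! ### The values of `Ind(Q)` -/

section

variable {C : Type u₁} [Category.{v} C] {D : Type u₂} [Category.{v} D]

/-- An ind-object is determined by the morphisms to it from objects of `C`, since these are the
sections of the underlying presheaf. -/
instance : (Ind.yoneda (C := C)).IsDense := by
  let e : Ind.inclusion C ⋙ (Functor.whiskeringRight _ _ _).obj uliftFunctor.{v, v} ≅
      Presheaf.restrictedULiftYoneda.{v} (Ind.yoneda (C := C)) :=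
    NatIso.ofComponents (fun W => NatIso.ofComponents
      (fun X => (Equiv.ulift.trans ((indYonedaHomEquiv X.unop W).symm.trans
        Equiv.ulift.{v}.symm)).toIso) (by
        intro X Y f
        ext x
        obtain ⟨x⟩ := x
        obtain ⟨x, rfl⟩ := (indYonedaHomEquiv X.unop W).surjective x
        refine congrArg ULift.up ?_
        refine ((indYonedaHomEquiv Y.unop W).symm_apply_eq.2
          (indYonedaHomEquiv_map_comp f.unop x).symm).trans ?_
        exact congrArg (Ind.yoneda.map f.unop ≫ ·) (Equiv.symm_apply_apply _ x).symm)) (by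
      intro W W' g
      ext X x
      obtain ⟨x⟩ := x
      obtain ⟨x, rfl⟩ := (indYonedaHomEquiv X.unop W).surjective x
      refine congrArg ULift.up ?_
      refine ((indYonedaHomEquiv X.unop W').symm_apply_eq.2
        (indYonedaHomEquiv_comp x g).symm).trans ?_
      exact congrArg (· ≫ g) (Equiv.symm_apply_apply _ x).symm)
  exact .of_fullyFaithful_restrictedULiftYoneda
    ((Ind.inclusion.fullyFaithful.comp (fullyFaithfulULiftFunctor.whiskeringRight _)).ofIso e)

/-- The comparison of `Ind(Q)` with `Q` on the objects of `C`. -/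
noncomputable def indMapUnit (Q : C ⥤ D) : Q ⋙ Ind.yoneda ⟶ Ind.yoneda ⋙ indMap Q :=
  Ind.yoneda.leftKanExtensionUnit (Q ⋙ Ind.yoneda)

/-- The morphism `Q(Y) ⟶ Ind(Q)(P)` given by a morphism `Y ⟶ P` from an object of `C` to an
ind-object. -/
noncomputable def indMapι (Q : C ⥤ D) {P : Ind C} {Y : C} (y : Ind.yoneda.obj Y ⟶ P) :
    Ind.yoneda.obj (Q.obj Y) ⟶ (indMap Q).obj P :=
  (indMapUnit Q).app Y ≫ (indMap Q).map y

lemma indMapι_map (Q : C ⥤ D) {P P' : Ind C} {Y : C} (y : Ind.yoneda.obj Y ⟶ P) (f : P ⟶ P') :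
    indMapι Q y ≫ (indMap Q).map f = indMapι Q (y ≫ f) := by
  simp [indMapι]

lemma map_comp_indMapι (Q : C ⥤ D) {P : Ind C} {Y Y' : C} (g : Y ⟶ Y')
    (y : Ind.yoneda.obj Y' ⟶ P) :
    Ind.yoneda.map (Q.map g) ≫ indMapι Q y = indMapι Q (Ind.yoneda.map g ≫ y) := by
  have := (indMapUnit Q).naturality_assoc g ((indMap Q).map y)
  dsimp at this
  simp [indMapι, this]

instance (P : Ind C) (X : D) :
    PreservesColimitsOfShape (CostructuredArrow Ind.yoneda P)
      (coyoneda.obj (op (Ind.yoneda.obj X))) := by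
  let e :=  ((CostructuredArrow.post Ind.yoneda (Ind.inclusion C) P).asEquivalence.trans
      (CostructuredArrow.mapNatIso Ind.yonedaCompInclusion))
  let G : P.presentation.I ⥤ CostructuredArrow Ind.yoneda P :=
    P.presentation.toCostructuredArrow ⋙ e.inverse
  exact Functor.Final.preservesColimitsOfShape_of_final G _

variable (Q : C ⥤ D)

/-- The value of `Ind(Q)` at `P` is a colimit. -/
noncomputable def indMapIsColimit (P : Ind C) :
    IsColimit ((Functor.LeftExtension.mk (indMap Q)
      (Ind.yoneda.leftKanExtensionUnit (Q ⋙ Ind.yoneda))).coconeAt P) :=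
  Ind.yoneda.isPointwiseLeftKanExtensionLeftKanExtensionUnit (Q ⋙ Ind.yoneda) P

lemma exists_map_comp_indMapι {P : Ind C} {X : D} (f : Ind.yoneda.obj X ⟶ (indMap Q).obj P) :
    ∃ (Y : C) (y : Ind.yoneda.obj Y ⟶ P) (a : X ⟶ Q.obj Y),
      Ind.yoneda.map a ≫ indMapι Q y = f := by
  obtain ⟨i, g, hg⟩ := Types.jointly_surjective _
    (isColimitOfPreserves (coyoneda.obj (op (Ind.yoneda.obj X))) (indMapIsColimit Q P)) f
  obtain ⟨g, rfl⟩ := Ind.yoneda.map_surjective g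
  exact ⟨i.left, i.hom, g, hg⟩

lemma exists_of_map_comp_indMapι_eq {P : Ind C} {X : D} {Y Y' : C} {y : Ind.yoneda.obj Y ⟶ P}
    {y' : Ind.yoneda.obj Y' ⟶ P} {a : X ⟶ Q.obj Y} {a' : X ⟶ Q.obj Y'}
    (h : Ind.yoneda.map a ≫ indMapι Q y = Ind.yoneda.map a' ≫ indMapι Q y') :
    ∃ (Y'' : C) (y'' : Ind.yoneda.obj Y'' ⟶ P) (g : Y ⟶ Y'') (g' : Y' ⟶ Y''),
      Ind.yoneda.map g ≫ y'' = y ∧ Ind.yoneda.map g' ≫ y'' = y' ∧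
        a ≫ Q.map g = a' ≫ Q.map g' := by
  obtain ⟨k, f, g, hfg⟩ := (Types.FilteredColimit.isColimit_eq_iff _
    (isColimitOfPreserves (coyoneda.obj (op (Ind.yoneda.obj X))) (indMapIsColimit Q P))
    (i := CostructuredArrow.mk y) (j := CostructuredArrow.mk y') (xi := Ind.yoneda.map a)
    (xj := Ind.yoneda.map a')).1 h
  refine ⟨k.left, k.hom, f.left, g.left, CostructuredArrow.w f, CostructuredArrow.w g,
    Ind.yoneda.map_injective ?_⟩
  rw [Functor.map_comp, Functor.map_comp]
  exact hfg

end

/-! ### The ind-adjoint -/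

section

variable {C : Type u₁} [Category.{v} C] {C' : Type u₂} [Category.{v} C'] (ι : C ⥤ C')
  (hι : ∀ Z : C', IsIndObject (ι.op ⋙ yoneda.obj Z))

/-- The presheaf underlying the ind-adjoint. -/
noncomputable def indAdjointCompInclusion :
    indAdjoint ι hι ⋙ Ind.inclusion C ≅
      yoneda ⋙ (Functor.whiskeringLeft _ _ (Type v)).obj ι.op :=
  Functor.isoWhiskerLeft
    (ObjectProperty.lift IsIndObject
      (yoneda ⋙ (Functor.whiskeringLeft _ _ (Type v)).obj ι.op) hι)
    (Functor.isoWhiskerRight (Ind.equivalence C).counitIso (ObjectProperty.ι _))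

/-- The universal property of the ind-adjoint. -/
noncomputable def indAdjointHomEquiv (Y : C) (Z : C') :
    (Ind.yoneda.obj Y ⟶ (indAdjoint ι hι).obj Z) ≃ (ι.obj Y ⟶ Z) :=
  (indYonedaHomEquiv Y _).trans
    (((indAdjointCompInclusion ι hι).app Z).app (op Y)).toEquiv

lemma indAdjointHomEquiv_map_comp {Y Y' : C} {Z : C'} (g : Y ⟶ Y')
    (y : Ind.yoneda.obj Y' ⟶ (indAdjoint ι hι).obj Z) :
    indAdjointHomEquiv ι hι Y Z (Ind.yoneda.map g ≫ y) =
      ι.map g ≫ indAdjointHomEquiv ι hι Y' Z y := by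
  refine (congrArg (((indAdjointCompInclusion ι hι).hom.app Z).app (op Y))
    (indYonedaHomEquiv_map_comp g y)).trans ?_
  exact ConcreteCategory.congr_hom (((indAdjointCompInclusion ι hι).hom.app Z).naturality g.op)
    (indYonedaHomEquiv Y' _ y)

lemma indAdjointHomEquiv_comp {Y : C} {Z Z' : C'}
    (y : Ind.yoneda.obj Y ⟶ (indAdjoint ι hι).obj Z) (g : Z ⟶ Z') :
    indAdjointHomEquiv ι hι Y Z' (y ≫ (indAdjoint ι hι).map g) =
      indAdjointHomEquiv ι hι Y Z y ≫ g := by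
  refine (congrArg (((indAdjointCompInclusion ι hι).hom.app Z').app (op Y))
    (indYonedaHomEquiv_comp y _)).trans ?_
  exact ConcreteCategory.congr_hom
    (NatTrans.congr_app ((indAdjointCompInclusion ι hι).hom.naturality g) (op Y))
    (indYonedaHomEquiv Y _ y)

end

/-! ### Squares of fractions -/

section

variable {C : Type u₁} [Category.{v} C] {C' : Type u₂} [Category.{v} C'] {D : Type u₃}
  [Category.{v} D] {D' : Type u₄} [Category.{w'} D']

/-- A commutative square of functors
```
C  ⥤  C'
|     |
D  ⥤  D'
```
such that `D` and `D'` are approximated by `C` and `C'` as localizations by a calculus of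
fractions would: morphisms `Q'(ι(X)) ⟶ Q'(Z)` with `X` in `C` are represented by fractions whose
denominators lie in `C`, and if two morphisms `ι(Y) ⟶ Z` become equal in `D'`, this is already
visible in `D` after refining `Y` and factoring through objects of `C`. -/
structure FractionSquare (ι : C ⥤ C') (Q : C ⥤ D) (Q' : C' ⥤ D') (ιD : D ⥤ D') where
  /-- The commutativity of the square. -/
  iso : Q ⋙ ιD ≅ ι ⋙ Q'
  essSurj : Q.EssSurj
  exists_fac {X Y : C} (a : Q.obj X ⟶ Q.obj Y) :
    ∃ (X₁ : C) (t : X₁ ⟶ X) (b : X₁ ⟶ Y), IsIso (Q.map t) ∧ Q.map t ≫ a = Q.map b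
  exists_fac' {X : C} {Z : C'} (φ : Q'.obj (ι.obj X) ⟶ Q'.obj Z) :
    ∃ (X₁ : C) (t : X₁ ⟶ X) (y : ι.obj X₁ ⟶ Z), IsIso (Q.map t) ∧
      Q'.map (ι.map t) ≫ φ = Q'.map y
  exists_eq {Y : C} {Z : C'} (y₁ y₂ : ι.obj Y ⟶ Z) (h : Q'.map y₁ = Q'.map y₂) :
    ∃ (Y₁ Y₂ : C) (t : Y₁ ⟶ Y) (i₁ i₂ : Y₁ ⟶ Y₂) (k : ι.obj Y₂ ⟶ Z), IsIso (Q.map t) ∧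
      Q.map i₁ = Q.map i₂ ∧ ι.map t ≫ y₁ = ι.map i₁ ≫ k ∧ ι.map t ≫ y₂ = ι.map i₂ ≫ k

namespace FractionSquare

variable {ι : C ⥤ C'} {Q : C ⥤ D} {Q' : C' ⥤ D'} {ιD : D ⥤ D'} (S : FractionSquare ι Q Q' ιD)
  (hι : ∀ Z : C', IsIndObject (ι.op ⋙ yoneda.obj Z))

/-- The morphism `ιD(X) ⟶ Q'(Z)` given by `a : X ⟶ Q(Y)` and `y : ι(Y) ⟶ Z`. -/
def hom {X : D} {Y : C} {Z : C'} (a : X ⟶ Q.obj Y) (y : ι.obj Y ⟶ Z) : ιD.obj X ⟶ Q'.obj Z :=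
  ιD.map a ≫ S.iso.hom.app Y ≫ Q'.map y

lemma hom_map_comp {X : D} {Y Y' : C} {Z : C'} (a : X ⟶ Q.obj Y) (g : Y ⟶ Y')
    (y : ι.obj Y' ⟶ Z) : S.hom a (ι.map g ≫ y) = S.hom (a ≫ Q.map g) y := by
  have := S.iso.hom.naturality_assoc g (Q'.map y)
  dsimp at this
  simp [hom, this]

lemma map_comp_hom {X X' : D} {Y : C} {Z : C'} (f : X' ⟶ X) (a : X ⟶ Q.obj Y) (y : ι.obj Y ⟶ Z) :
    ιD.map f ≫ S.hom a y = S.hom (f ≫ a) y := by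
  simp [hom]

lemma hom_comp_map {X : D} {Y : C} {Z Z' : C'} (a : X ⟶ Q.obj Y) (y : ι.obj Y ⟶ Z) (g : Z ⟶ Z') :
    S.hom a y ≫ Q'.map g = S.hom a (y ≫ g) := by
  simp [hom]

include S in
lemma exists_fac₂ {X : D} {Y Y' : C} (a : X ⟶ Q.obj Y) (a' : X ⟶ Q.obj Y') :
    ∃ (X₁ : C) (s : Q.obj X₁ ⟶ X) (b : X₁ ⟶ Y) (b' : X₁ ⟶ Y'), IsIso s ∧ s ≫ a = Q.map b ∧
      s ≫ a' = Q.map b' := by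
  have := S.essSurj
  obtain ⟨X₁, t, b, _, h⟩ := S.exists_fac ((Q.objObjPreimageIso X).hom ≫ a)
  obtain ⟨X₂, t', b', _, h'⟩ := S.exists_fac (Q.map t ≫ (Q.objObjPreimageIso X).hom ≫ a')
  exact ⟨X₂, Q.map t' ≫ Q.map t ≫ (Q.objObjPreimageIso X).hom, t' ≫ b, b', inferInstance,
    by simp [h], by simp [h']⟩

lemma exists_hom_eq {X : D} {Z : C'} (φ : ιD.obj X ⟶ Q'.obj Z) :
    ∃ (Y : C) (a : X ⟶ Q.obj Y) (y : ι.obj Y ⟶ Z), IsIso a ∧ S.hom a y = φ := by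
  have := S.essSurj
  obtain ⟨Y, t, y, _, h⟩ := S.exists_fac'
    (S.iso.inv.app _ ≫ ιD.map (Q.objObjPreimageIso X).hom ≫ φ)
  refine ⟨Y, (Q.objObjPreimageIso X).inv ≫ inv (Q.map t), y, inferInstance, ?_⟩
  have := S.iso.hom.naturality t
  dsimp at this
  rw [← cancel_epi (ιD.map (Q.map t ≫ (Q.objObjPreimageIso X).hom)), S.map_comp_hom]
  simp only [hom, ← h, ← reassoc_of% this, Functor.map_comp, Category.assoc]
  simp

/-- Two pairs `(a, y)` and `(a', y')` define the same morphism to `Ind(Q)(indAdjoint ι Z)` if and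
only if they define the same morphism to `Q'(Z)`. -/
lemma map_comp_indMapι_eq_iff {X : D} {Y Y' : C} {Z : C'} (a : X ⟶ Q.obj Y)
    (y : Ind.yoneda.obj Y ⟶ (indAdjoint ι hι).obj Z) (a' : X ⟶ Q.obj Y')
    (y' : Ind.yoneda.obj Y' ⟶ (indAdjoint ι hι).obj Z) :
    Ind.yoneda.map a ≫ indMapι Q y = Ind.yoneda.map a' ≫ indMapι Q y' ↔
      S.hom a (indAdjointHomEquiv ι hι _ _ y) = S.hom a' (indAdjointHomEquiv ι hι _ _ y') := by
  constructor
  · intro h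
    obtain ⟨Y'', y'', g, g', rfl, rfl, hg⟩ := exists_of_map_comp_indMapι_eq Q h
    rw [indAdjointHomEquiv_map_comp, indAdjointHomEquiv_map_comp, hom_map_comp, hom_map_comp, hg]
  · intro h
    obtain ⟨X₁, s, b, b', _, hb, hb'⟩ := S.exists_fac₂ a a'
    obtain ⟨Y₁, Y₂, t, i₁, i₂, k, _, hi, h₁, h₂⟩ := S.exists_eq
      (ι.map b ≫ indAdjointHomEquiv ι hι _ _ y) (ι.map b' ≫ indAdjointHomEquiv ι hι _ _ y') (by
        replace h : ιD.map s ≫ S.hom a _ = ιD.map s ≫ S.hom a' _ := congrArg (ιD.map s ≫ ·) h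
        rw [map_comp_hom, map_comp_hom, hb, hb', ← Category.id_comp (Q.map b),
          ← Category.id_comp (Q.map b'), ← hom_map_comp, ← hom_map_comp] at h
        simpa [hom] using h)
    obtain ⟨k, rfl⟩ := (indAdjointHomEquiv ι hι _ _).surjective k
    simp only [← indAdjointHomEquiv_map_comp, EmbeddingLike.apply_eq_iff_eq] at h₁ h₂
    rw [← cancel_epi (Ind.yoneda.map (Q.map t ≫ s))]
    simp only [← Functor.map_comp_assoc, Category.assoc, hb, hb']
    simp only [Functor.map_comp, Category.assoc, map_comp_indMapι, h₁, h₂]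
    simp only [← map_comp_indMapι, hi]

/-- The morphisms from an object of `D` to `Ind(Q)(indAdjoint ι Z)` are the morphisms to `Q'(Z)`
in `D'`. -/
lemma exists_homEquiv (X : D) (Z : C') :
    ∃ e : (Ind.yoneda.obj X ⟶ (indMap Q).obj ((indAdjoint ι hι).obj Z)) ≃ (ιD.obj X ⟶ Q'.obj Z),
      ∀ (Y : C) (a : X ⟶ Q.obj Y) (y : Ind.yoneda.obj Y ⟶ (indAdjoint ι hι).obj Z),
        e (Ind.yoneda.map a ≫ indMapι Q y) = S.hom a (indAdjointHomEquiv ι hι _ _ y) := by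
  choose Y y a h using fun f : Ind.yoneda.obj X ⟶ (indMap Q).obj ((indAdjoint ι hι).obj Z) =>
    exists_map_comp_indMapι Q f
  have key : ∀ (Y' : C) (a' : X ⟶ Q.obj Y') (y' : Ind.yoneda.obj Y' ⟶ (indAdjoint ι hι).obj Z),
      S.hom (a (Ind.yoneda.map a' ≫ indMapι Q y'))
        (indAdjointHomEquiv ι hι _ _ (y (Ind.yoneda.map a' ≫ indMapι Q y'))) =
          S.hom a' (indAdjointHomEquiv ι hι _ _ y') := fun Y' a' y' =>
    (S.map_comp_indMapι_eq_iff hι _ _ _ _).1 (h _)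
  refine ⟨Equiv.ofBijective (fun f => S.hom (a f) (indAdjointHomEquiv ι hι _ _ (y f)))
    ⟨fun f f' hf => ?_, fun φ => ?_⟩, key⟩
  · rw [← h f, ← h f']
    exact (S.map_comp_indMapι_eq_iff hι _ _ _ _).2 hf
  · obtain ⟨Y', a', y', -, rfl⟩ := S.exists_hom_eq φ
    obtain ⟨y', rfl⟩ := (indAdjointHomEquiv ι hι _ _).surjective y'
    exact ⟨_, key _ _ _⟩

/-- The equivalence of `exists_homEquiv`. -/
noncomputable def homEquiv (X : D) (Z : C') :
    (Ind.yoneda.obj X ⟶ (indMap Q).obj ((indAdjoint ι hι).obj Z)) ≃ (ιD.obj X ⟶ Q'.obj Z) :=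
  (S.exists_homEquiv hι X Z).choose

lemma homEquiv_map_comp_indMapι {X : D} {Y : C} {Z : C'} (a : X ⟶ Q.obj Y)
    (y : Ind.yoneda.obj Y ⟶ (indAdjoint ι hι).obj Z) :
    S.homEquiv hι X Z (Ind.yoneda.map a ≫ indMapι Q y) =
      S.hom a (indAdjointHomEquiv ι hι _ _ y) :=
  (S.exists_homEquiv hι X Z).choose_spec Y a y

lemma homEquiv_map_comp {X X' : D} {Z : C'} (g : X' ⟶ X)
    (f : Ind.yoneda.obj X ⟶ (indMap Q).obj ((indAdjoint ι hι).obj Z)) :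
    S.homEquiv hι X' Z (Ind.yoneda.map g ≫ f) = ιD.map g ≫ S.homEquiv hι X Z f := by
  obtain ⟨Y, y, a, rfl⟩ := exists_map_comp_indMapι Q f
  rw [← Functor.map_comp_assoc, homEquiv_map_comp_indMapι, homEquiv_map_comp_indMapι,
    map_comp_hom]

lemma homEquiv_comp {X : D} {Z Z' : C'}
    (f : Ind.yoneda.obj X ⟶ (indMap Q).obj ((indAdjoint ι hι).obj Z)) (g : Z ⟶ Z') :
    S.homEquiv hι X Z' (f ≫ (indMap Q).map ((indAdjoint ι hι).map g)) =
      S.homEquiv hι X Z f ≫ Q'.map g := by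
  obtain ⟨Y, y, a, rfl⟩ := exists_map_comp_indMapι Q f
  rw [Category.assoc, indMapι_map, homEquiv_map_comp_indMapι, homEquiv_map_comp_indMapι,
    hom_comp_map, indAdjointHomEquiv_comp]

/-- The presheaves on `D` defined by `Ind(Q) ∘ indAdjoint ι` and by `Q'` agree. -/
noncomputable def restrictedULiftYonedaIso :
    (indAdjoint ι hι ⋙ indMap Q) ⋙ Presheaf.restrictedULiftYoneda.{w'} (Ind.yoneda (C := D)) ≅
      Q' ⋙ Presheaf.restrictedULiftYoneda.{v} ιD :=
  NatIso.ofComponents (fun Z => NatIso.ofComponents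
    (fun X => (Equiv.ulift.{w'}.trans ((S.homEquiv hι X.unop Z).trans Equiv.ulift.{v}.symm)).toIso)
    (fun g => by
      ext f
      exact congrArg ULift.up (S.homEquiv_map_comp hι g.unop f.down)))
    (fun g => by
      ext X f
      exact congrArg ULift.up (S.homEquiv_comp hι f.down g))

end FractionSquare

end

/-! ### Presentations of ind-objects by objects with a given property -/

section

variable {C : Type u} [Category.{v} C]

/-- If every section of an ind-object comes from a section over an object with the property `S`,
then the ind-object is a filtered colimit of objects with the property `S`. -/
lemma exists_indObjectPresentation {W : Cᵒᵖ ⥤ Type v} (hW : IsIndObject W) (S : ObjectProperty C)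
    (h : ∀ (U : C) (x : W.obj (op U)), ∃ (V : C) (u : U ⟶ V) (y : W.obj (op V)),
      S V ∧ W.map u.op y = x) :
    ∃ P : IndObjectPresentation W, ∀ i, S (P.F.obj i) := by
  have := hW.isFiltered
  have := hW.finallySmall
  have hr : ∀ j : CostructuredArrow yoneda W, ∃ k : CostructuredArrow yoneda W,
      S k.left ∧ Nonempty (j ⟶ k) := fun j => by
    obtain ⟨V, u, y, hV, hy⟩ := h j.left (yonedaEquiv j.hom)
    refine ⟨CostructuredArrow.mk (yonedaEquiv.symm y), hV, ⟨CostructuredArrow.homMk u ?_⟩⟩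
    apply yonedaEquiv.injective
    dsimp
    rw [← hy, ← yonedaEquiv_naturality]
    simp
  -- The images under `r` of a small weakly terminal set form a small final subcategory.
  choose r hr hr' using hr
  obtain ⟨s₀, _, hs₀⟩ := FinallySmall.exists_small_weakly_terminal_set
    (J := CostructuredArrow yoneda W)
  let s : ObjectProperty (CostructuredArrow yoneda W) := (· ∈ r '' s₀)
  have : Small.{v} (r '' s₀) := inferInstance
  have hs : ∀ j, ∃ k : s.FullSubcategory, Nonempty (j ⟶ s.ι.obj k) := fun j => by
    obtain ⟨k, hk, ⟨f⟩⟩ := hs₀ j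
    exact ⟨⟨r k, k, hk, rfl⟩, ⟨f ≫ (hr' k).some⟩⟩
  have : IsFiltered s.FullSubcategory := .of_exists_of_isFiltered_of_fullyFaithful s.ι hs
  have : s.ι.Final := Functor.final_of_exists_of_isFiltered_of_fullyFaithful s.ι hs
  have : EssentiallySmall.{v} s.FullSubcategory := by
    have : Small.{v} s.FullSubcategory :=
      small_of_injective (β := r '' s₀) (f := fun k => ⟨k.obj, k.property⟩)
        (fun k k' hkk' => by
          cases k
          cases k'
          simpa using hkk')
    exact essentiallySmall_of_small_of_locallySmall _
  let G : SmallModel.{v} s.FullSubcategory ⥤ CostructuredArrow yoneda W :=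
    (equivSmallModel.{v} _).inverse ⋙ s.ι
  have : IsFiltered (SmallModel.{v} s.FullSubcategory) := .of_equivalence (equivSmallModel.{v} _)
  have hc := (Functor.Final.isColimitWhiskerEquiv G _).symm (Presheaf.isColimitTautologicalCocone W)
  refine ⟨⟨_, G ⋙ CostructuredArrow.proj yoneda W, _, hc⟩, fun i => ?_⟩
  obtain ⟨k, -, hk⟩ := ((equivSmallModel.{v} s.FullSubcategory).inverse.obj i).property
  change S ((equivSmallModel.{v} s.FullSubcategory).inverse.obj i).obj.left
  rw [← hk]
  exact hr k

lemma exists_presentation_of_factorization (X : Ind C) (S : ObjectProperty C)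
    (h : ∀ (U : C) (x : Ind.yoneda.obj U ⟶ X), ∃ (V : C) (u : U ⟶ V) (y : Ind.yoneda.obj V ⟶ X),
      S V ∧ Ind.yoneda.map u ≫ y = x) :
    ∃ P : IndObjectPresentation ((Ind.inclusion C).obj X), ∀ i, S (P.F.obj i) := by
  refine exists_indObjectPresentation X.isIndObject_inclusion_obj S (fun U x => ?_)
  obtain ⟨x, rfl⟩ := (indYonedaHomEquiv U X).surjective x
  obtain ⟨V, u, y, hV, rfl⟩ := h U x
  exact ⟨V, u, indYonedaHomEquiv V X y, hV, (indYonedaHomEquiv_map_comp u y).symm⟩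

end

/-- If every morphism `ι(Y) ⟶ Z` factors through some `ι(Y')` such that `Q(Y')` has the property
`P`, then `Ind(Q)(indAdjoint ι Z)` is a filtered colimit of objects with the property `P`. -/
lemma exists_presentation_indMap_indAdjoint {C : Type u₁} [Category.{v} C] {C' : Type u₂}
    [Category.{v} C'] {D : Type u₃} [Category.{v} D] {ι : C ⥤ C'}
    (hι : ∀ Z : C', IsIndObject (ι.op ⋙ yoneda.obj Z)) (Q : C ⥤ D) (Z : C')
    (P : ObjectProperty D)
    (h : ∀ (Y : C) (y : ι.obj Y ⟶ Z), ∃ (Y' : C) (t : Y ⟶ Y') (y' : ι.obj Y' ⟶ Z),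
      P (Q.obj Y') ∧ ι.map t ≫ y' = y) :
    ∃ p : IndObjectPresentation
      ((Ind.inclusion D).obj ((indMap Q).obj ((indAdjoint ι hι).obj Z))), ∀ i, P (p.F.obj i) := by
  refine exists_presentation_of_factorization _ _ (fun U x => ?_)
  obtain ⟨Y, y, a, rfl⟩ := exists_map_comp_indMapι Q x
  obtain ⟨Y', t, y', hY', h⟩ := h Y (indAdjointHomEquiv ι hι _ _ y)
  obtain ⟨y', rfl⟩ := (indAdjointHomEquiv ι hι _ _).surjective y'
  rw [← indAdjointHomEquiv_map_comp, EmbeddingLike.apply_eq_iff_eq] at h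
  exact ⟨Q.obj Y', a ≫ Q.map t, indMapι Q y', hY', by
    rw [Functor.map_comp, Category.assoc, map_comp_indMapι, h]⟩

/-! ### The functor induced by a square of fractions -/

namespace FractionSquare

variable {C : Type u₁} [Category.{v} C] {C' : Type u₂} [Category.{v} C'] {D : Type u₃}
  [Category.{v} D] {D' : Type u₄} [Category.{w'} D']
  {ι : C ⥤ C'} {Q : C ⥤ D} {Q' : C' ⥤ D'} {ιD : D ⥤ D'} (S : FractionSquare ι Q Q' ιD)
  (hι : ∀ Z : C', IsIndObject (ι.op ⋙ yoneda.obj Z))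

include S in
/-- If every object of `D'` comes from `C'`, the functor `Ind(Q) ∘ indAdjoint ι` factors through
`D'`: as presheaves on `D`, its values are the morphisms `ιD(-) ⟶ Q'(Z)`. -/
lemma exists_functor [Q'.EssSurj] :
    ∃ J : D' ⥤ Ind D, Nonempty (Q' ⋙ J ≅ indAdjoint ι hι ⋙ indMap Q) := by
  let N := Presheaf.restrictedULiftYoneda.{w'} (Ind.yoneda (C := D))
  let G := Presheaf.restrictedULiftYoneda.{v} ιD
  let e : (indAdjoint ι hι ⋙ indMap Q) ⋙ N ≅ Q' ⋙ G := S.restrictedULiftYonedaIso hι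
  have hG : ∀ W, N.essImage (G.obj W) := fun W =>
    ⟨_, ⟨e.app (Q'.objPreimage W) ≪≫ G.mapIso (Q'.objObjPreimageIso W)⟩⟩
  refine ⟨Functor.essImage.liftFunctor G N hG, ⟨((Functor.FullyFaithful.ofFullyFaithful
    N).whiskeringRight C').preimageIso ?_⟩⟩
  exact Functor.isoWhiskerLeft Q' (Functor.essImage.liftFunctorCompIso G N hG) ≪≫ e.symm

include S in
/-- If `Ind(Q)(indAdjoint ι g)` is an isomorphism, then `Q'(g)` looks like one to the objects of
`D`. -/
lemma bijective_of_isIso {Z Z' : C'} (g : Z ⟶ Z')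
    (hg : IsIso ((indMap Q).map ((indAdjoint ι hι).map g))) (X : D) :
    Function.Bijective (fun f : ιD.obj X ⟶ Q'.obj Z => f ≫ Q'.map g) := by
  have h : (fun f : ιD.obj X ⟶ Q'.obj Z => f ≫ Q'.map g) =
      S.homEquiv hι X Z' ∘ (fun f => f ≫ (indMap Q).map ((indAdjoint ι hι).map g)) ∘
        (S.homEquiv hι X Z).symm := by
    ext f
    simp [homEquiv_comp]
  rw [h]
  refine (S.homEquiv hι X Z').bijective.comp (.comp ?_ (S.homEquiv hι X Z).symm.bijective)
  exact ((asIso ((indMap Q).map ((indAdjoint ι hι).map g))).homToEquiv).bijective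

end FractionSquare

/-! ### Null-homotopic morphisms factor through contractible complexes of `A` -/

section

open CochainComplex HomComplex

variable {A : Type u₁} [Category.{v} A] [Abelian A] {B : Type u₂} [Category.{v} B] [Abelian B]
  (E : A ⥤ B) [E.Additive]

/-- A null-homotopic morphism from `E(Y)` factors through `E(cone(𝟙 Y))`. -/
lemma exists_comp_eq_of_homotopy_zero {Y : CochainComplex A ℤ} {Z : CochainComplex B ℤ}
    (f : (E.mapHomologicalComplex (.up ℤ)).obj Y ⟶ Z) (h : Homotopy f 0) :
    ∃ k : (E.mapHomologicalComplex (.up ℤ)).obj (mappingCone (𝟙 Y)) ⟶ Z,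
      (E.mapHomologicalComplex (.up ℤ)).map (mappingCone.inr (𝟙 Y)) ≫ k = f := by
  let φ := (E.mapHomologicalComplex (.up ℤ)).map (𝟙 Y)
  have hφ : φ ≫ f = f := by simp [φ]
  refine ⟨(mappingCone.mapHomologicalComplexIso (𝟙 Y) E).hom ≫
    mappingCone.desc φ (Cochain.ofHomotopy h) f (by simp [hφ]), ?_⟩
  rw [← Category.assoc, mappingCone.map_inr, mappingCone.inr_desc]

lemma δ_inl_mappingCocone {K L : CochainComplex A ℤ} (φ : K ⟶ L) :
    δ 0 1 (mappingCocone.inl φ) =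
      -(Cochain.ofHom φ).comp (mappingCocone.inr φ).1 (zero_add 1) := by
  have h : mappingCocone.inl φ = mappingCocone.liftCochain φ (Cochain.ofHom (𝟙 K)) 0
      (neg_add_cancel 1) := by
    simp [mappingCocone.inl, mappingCocone.liftCochain, mappingCone.liftCochain]
    rfl
  rw [h, mappingCocone.δ_liftCochain _ _ _ _ 1 rfl]
  simp

/-- A null-homotopic morphism to `E(Y)` factors through `E(cocone(𝟙 Y))`. -/
lemma exists_eq_comp_of_homotopy_zero {Y : CochainComplex A ℤ} {Z : CochainComplex B ℤ}
    (f : Z ⟶ (E.mapHomologicalComplex (.up ℤ)).obj Y) (h : Homotopy f 0) :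
    ∃ k : Z ⟶ (E.mapHomologicalComplex (.up ℤ)).obj (mappingCocone (𝟙 Y)),
      k ≫ (E.mapHomologicalComplex (.up ℤ)).map (mappingCocone.fst (𝟙 Y)) = f := by
  -- The lift has the components `f` and a null-homotopy of `f`.
  let z : Cochain Z ((E.mapHomologicalComplex (.up ℤ)).obj (mappingCocone (𝟙 Y))) 0 :=
    (Cochain.ofHom f).comp ((mappingCocone.inl (𝟙 Y)).map E) (add_zero 0) -
      (Cochain.ofHomotopy h).comp ((mappingCocone.inr (𝟙 Y)).1.map E) (neg_add_cancel 1)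
  have hz : δ 0 1 z = 0 := by
    dsimp only [z]
    rw [δ_sub, δ_comp _ _ _ 1 1 1 rfl rfl rfl, δ_comp _ _ (neg_add_cancel 1) 0 2 1 rfl rfl rfl,
      δ_map, δ_map, δ_inl_mappingCocone, (mappingCocone.inr (𝟙 Y)).δ_eq_zero]
    simp
  refine ⟨(Cocycle.mk z 1 rfl hz).homOf, ?_⟩
  ext p
  have key (f' : Z.X p ⟶ E.obj (Y.X p)) (h' : Z.X p ⟶ E.obj (Y.X (p + -1))) :
      (f' ≫ E.map ((mappingCocone.inl (𝟙 Y)).v p p (add_zero p)) -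
        h' ≫ E.map ((mappingCocone.inr (𝟙 Y)).1.v (p + -1) p (by simp))) ≫
          E.map ((mappingCocone.fst (𝟙 Y)).f p) = f' := by
    rw [Preadditive.sub_comp, Category.assoc, Category.assoc, ← E.map_comp, ← E.map_comp,
      mappingCocone.inl_v_fst_f, mappingCocone.inr_v_fst_f, E.map_id, E.map_zero, comp_zero,
      sub_zero, Category.comp_id]
  have hzp : z.v p p (add_zero p) = f.f p ≫ E.map ((mappingCocone.inl (𝟙 Y)).v p p (add_zero p)) -
      (Cochain.ofHomotopy h).v p (p + -1) rfl ≫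
        E.map ((mappingCocone.inr (𝟙 Y)).1.v (p + -1) p (by simp)) := by
    dsimp only [z]
    rw [Cochain.sub_v, Cochain.comp_v _ _ (neg_add_cancel 1) p (p + -1) p rfl (by simp),
      Cochain.comp_v _ _ (add_zero 0) p p p (add_zero p) (add_zero p), Cochain.ofHom_v]
    rfl
  exact (congrArg (· ≫ E.map ((mappingCocone.fst (𝟙 Y)).f p)) hzp).trans (key _ _)

end

/-! ### The bounded derived category as a localization -/

section

variable {A : Type u₁} [Category.{v} A] [Abelian A]

open CochainComplex in
lemma boundedComplex_mappingCone {K L : CochainComplex A ℤ} (φ : K ⟶ L) (hK : boundedComplex A K)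
    (hL : boundedComplex A L) : boundedComplex A (mappingCone φ) := by
  obtain ⟨a, b, _, _⟩ := hK
  obtain ⟨a', b', _, _⟩ := hL
  refine ⟨min (a - 1) a', max (b - 1) b', ?_, ?_⟩
  · rw [isStrictlyGE_iff]
    intro i hi
    rw [lt_min_iff] at hi
    rw [mappingCone.isZero_X_iff]
    exact ⟨K.isZero_of_isStrictlyGE a _ (by lia), L.isZero_of_isStrictlyGE a' _ hi.2⟩
  · rw [isStrictlyLE_iff]
    intro i hi
    rw [max_lt_iff] at hi
    rw [mappingCone.isZero_X_iff]
    exact ⟨K.isZero_of_isStrictlyLE b _ (by lia), L.isZero_of_isStrictlyLE b' _ hi.2⟩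

open CochainComplex in
lemma boundedComplex_mappingCocone {K L : CochainComplex A ℤ} (φ : K ⟶ L)
    (hK : boundedComplex A K) (hL : boundedComplex A L) :
    boundedComplex A (mappingCocone φ) := by
  obtain ⟨a, b, _, _⟩ := boundedComplex_mappingCone φ hK hL
  exact ⟨a + 1, b + 1, isStrictlyGE_shift (mappingCone φ) a (-1) (a + 1) (by lia),
    isStrictlyLE_shift (mappingCone φ) b (-1) (b + 1) (by lia)⟩

variable [HasDerivedCategory.{w} A]

instance : (Qb A).EssSurj where
  mem_essImage X := by
    obtain ⟨⟨a, ha⟩, ⟨b, hb⟩⟩ := X.property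
    have : X.obj.IsGE a := ha
    have : X.obj.IsLE b := hb
    obtain ⟨K, _, _, ⟨e⟩⟩ := DerivedCategory.exists_iso_Q_obj_of_isGE_of_isLE X.obj a b
    exact ⟨⟨K, a, b, inferInstance, inferInstance⟩,
      ⟨ObjectProperty.isoMk _ e.symm⟩⟩

lemma isIso_Qb_map_iff {X Y : Cb A} (f : X ⟶ Y) : IsIso ((Qb A).map f) ↔ QuasiIso f.hom := by
  rw [← DerivedCategory.isIso_Q_map_iff_quasiIso,
    ← isIso_iff_of_reflects_iso _ DerivedCategory.Bounded.ι]
  rfl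

omit [HasDerivedCategory.{w} A] in
lemma exists_common_bounds (X Y : Cb A) : ∃ a b : ℤ, X.obj.IsStrictlyGE a ∧ X.obj.IsStrictlyLE b ∧
    Y.obj.IsStrictlyGE a ∧ Y.obj.IsStrictlyLE b := by
  obtain ⟨a, b, _, _⟩ := X.property
  obtain ⟨a', b', _, _⟩ := Y.property
  exact ⟨min a a', max b b', X.obj.isStrictlyGE_of_ge _ a (min_le_left _ _),
    X.obj.isStrictlyLE_of_le b _ (le_max_left _ _),
    Y.obj.isStrictlyGE_of_ge _ a' (min_le_right _ _),
    Y.obj.isStrictlyLE_of_le b' _ (le_max_right _ _)⟩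

/-- The morphisms of `D^b(A)` are right fractions of morphisms of bounded complexes. -/
lemma exists_Qb_right_fac {X Y : Cb A} (f : (Qb A).obj X ⟶ (Qb A).obj Y) :
    ∃ (X' : Cb A) (t : X' ⟶ X) (g : X' ⟶ Y), IsIso ((Qb A).map t) ∧
      (Qb A).map t ≫ f = (Qb A).map g := by
  obtain ⟨a, b, _, _, _, _⟩ := exists_common_bounds X Y
  obtain ⟨X', _, _, s, hs, g, hf⟩ :=
    DerivedCategory.right_fac_of_isStrictlyLE_of_isStrictlyGE (X := X.obj) (Y := Y.obj) a b
      f.hom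
  refine ⟨⟨X', a, b, inferInstance, inferInstance⟩, ⟨s⟩, ⟨g⟩,
    (isIso_Qb_map_iff _).2 ((DerivedCategory.isIso_Q_map_iff_quasiIso _ s).1 hs), ?_⟩
  ext
  exact (IsIso.eq_inv_comp (DerivedCategory.Q.map s)).1 hf

/-- The morphisms of `D^b(A)` are left fractions of morphisms of bounded complexes. -/
lemma exists_Qb_left_fac {X Y : Cb A} (f : (Qb A).obj X ⟶ (Qb A).obj Y) :
    ∃ (Y' : Cb A) (t : Y ⟶ Y') (g : X ⟶ Y'), IsIso ((Qb A).map t) ∧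
      f ≫ (Qb A).map t = (Qb A).map g := by
  obtain ⟨a, b, _, _, _, _⟩ := exists_common_bounds X Y
  obtain ⟨X', _, _, g, s, hs, hf⟩ :=
    DerivedCategory.left_fac_of_isStrictlyLE_of_isStrictlyGE (X := X.obj) (Y := Y.obj) a b
      f.hom
  refine ⟨⟨X', a, b, inferInstance, inferInstance⟩, ⟨s⟩, ⟨g⟩,
    (isIso_Qb_map_iff _).2 ((DerivedCategory.isIso_Q_map_iff_quasiIso _ s).1 hs), ?_⟩
  ext
  exact (IsIso.eq_comp_inv (DerivedCategory.Q.map s)).1 hf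

end

/-! ### The square of fractions of an exact functor -/

section

variable {A : Type u₁} [Category.{v} A] [Abelian A] {B : Type u₂} [Category.{v} B] [Abelian B]
  (E : A ⥤ B) [E.Additive] [PreservesFiniteLimits E] [PreservesFiniteColimits E]
  [HasDerivedCategory.{w} A] [HasDerivedCategory.{w'} B]

/-- The functor `D^b(A) ⥤ D^b(B)` induced by an exact functor `A ⥤ B`. -/
noncomputable def mapDb : DerivedCategory.Bounded A ⥤ DerivedCategory.Bounded B :=
  ObjectProperty.lift _ (DerivedCategory.Bounded.ι ⋙ E.mapDerivedCategory) (fun X => by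
    let e := E.mapDerivedCategory.mapIso (DerivedCategory.Bounded.ι.mapIso
      ((Qb A).objObjPreimageIso X)).symm ≪≫
        E.mapDerivedCategoryFactors.app ((Qb A).objPreimage X).obj
    exact ObjectProperty.prop_of_iso _ e.symm
      ((Qb B).obj ((mapCb E).obj ((Qb A).objPreimage X))).property)

/-- The compatibility of `mapDb` with `mapCb`. -/
noncomputable def mapDbFactors : Qb A ⋙ mapDb E ≅ mapCb E ⋙ Qb B :=
  NatIso.ofComponents (fun X => ObjectProperty.isoMk _ (E.mapDerivedCategoryFactors.app X.obj))
    (fun f => by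
      ext
      exact E.mapDerivedCategoryFactors.hom.naturality f.hom)

variable {E}

omit [PreservesFiniteLimits E] [PreservesFiniteColimits E] [HasDerivedCategory.{w'} B] in
lemma exists_fac_of_homotopy_zero {Y : Cb A} {Z : Cb B} (f : (mapCb E).obj Y ⟶ Z)
    (h : Homotopy f.hom 0) :
    ∃ (N : Cb A) (j : Y ⟶ N) (k : (mapCb E).obj N ⟶ Z), (Qb A).map j = 0 ∧
      (mapCb E).map j ≫ k = f := by
  obtain ⟨k, hk⟩ := exists_comp_eq_of_homotopy_zero E f.hom h
  refine ⟨⟨_, boundedComplex_mappingCone (𝟙 Y.obj) Y.property Y.property⟩,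
    ⟨CochainComplex.mappingCone.inr _⟩, ⟨k⟩, ?_, ?_⟩
  · ext
    exact ((isZero_Q_obj_iff _).2 (acyclic_mappingCone (𝟙 Y.obj))).eq_of_tgt _ _
  · ext : 1
    exact hk

omit [PreservesFiniteLimits E] [PreservesFiniteColimits E] [HasDerivedCategory.{w'} B] in
lemma exists_fac_of_homotopy_zero' {Y : Cb A} {Z : Cb B} (f : Z ⟶ (mapCb E).obj Y)
    (h : Homotopy f.hom 0) :
    ∃ (N : Cb A) (j : N ⟶ Y) (k : Z ⟶ (mapCb E).obj N), (Qb A).map j = 0 ∧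
      k ≫ (mapCb E).map j = f := by
  obtain ⟨k, hk⟩ := exists_eq_comp_of_homotopy_zero E f.hom h
  refine ⟨⟨_, boundedComplex_mappingCocone (𝟙 Y.obj) Y.property Y.property⟩,
    ⟨CochainComplex.mappingCocone.fst _⟩, ⟨k⟩, ?_, ?_⟩
  · ext
    exact ((isZero_Q_obj_iff _).2 (acyclic_mappingCocone (𝟙 Y.obj))).eq_of_src _ _
  · ext : 1
    exact hk

end

section

variable {A : Type u₁} [Category.{v} A] [Abelian A] {B : Type u₂} [Category.{v} B] [Abelian B]
  {E : A ⥤ B} [E.Additive] [PreservesFiniteLimits E] [PreservesFiniteColimits E]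
  [HasDerivedCategory.{v} A] [HasDerivedCategory.{w'} B]

omit [PreservesFiniteLimits E] [PreservesFiniteColimits E] [HasDerivedCategory.{v} A]
  [HasDerivedCategory.{w'} B] in
instance : (mapCb E).Additive where
  map_add {X Y} f g := by
    ext : 1
    exact (E.mapHomologicalComplex (.up ℤ)).map_add

omit [HasDerivedCategory.{v} A] in
instance [HasDerivedCategory.{w} A] : (Qb A).Additive where
  map_add {X Y} f g := by
    ext
    exact DerivedCategory.Q.map_add

/-- The comparison of `D^b(A)` with `D^b(B)`, for an exact functor `E : A ⥤ B` such that the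
epimorphisms to objects in the image of `E` are dominated by epimorphisms of `A`. -/
noncomputable def fractionSquare (hE : RefinesEpi E) :
    FractionSquare (mapCb E) (Qb A) (Qb B) (mapDb E) where
  iso := mapDbFactors E
  essSurj := inferInstance
  exists_fac := exists_Qb_right_fac
  exists_fac' {X Z} φ := by
    obtain ⟨X', t, y, ht, h⟩ := hE.exists_right_fac X Z φ.hom
    refine ⟨X', t, y, (isIso_Qb_map_iff t).2 ht, ?_⟩
    ext
    exact h
  exists_eq {Y Z} y₁ y₂ h := by
    obtain ⟨Y₁, t, ht, ⟨h⟩⟩ := hE.exists_homotopy_of_Q_map_eq_zero (y₁ - y₂) (by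
      have h' := congrArg (·.hom) h
      exact (DerivedCategory.Q.map_sub (f := y₁.hom) (g := y₂.hom)).trans (sub_eq_zero.2 h'))
    obtain ⟨N, j, k, hj, hk⟩ := exists_fac_of_homotopy_zero _ h
    -- On `Y₁`, the morphisms `y₁` and `y₂` differ by a morphism that factors through the acyclic
    -- complex `N`. They factor through `Y₁ ⨯ N` by the graphs of `j` and of `0`, which have the
    -- same image in `D^b(A)`.
    let r₁ : Y₁ ⨯ N ⟶ Y₁ := prod.fst
    let r₂ : Y₁ ⨯ N ⟶ N := prod.snd
    have hl (u : Y₁ ⟶ N) : (mapCb E).map (prod.lift (𝟙 Y₁) u) ≫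
        ((mapCb E).map r₁ ≫ (mapCb E).map t ≫ y₂ + (mapCb E).map r₂ ≫ k) =
          (mapCb E).map t ≫ y₂ + (mapCb E).map u ≫ k := by
      simp only [Preadditive.comp_add, ← Functor.map_comp_assoc, r₁, r₂,
        prod.lift_snd, Category.id_comp, prod.lift_fst_assoc]
    refine ⟨Y₁, Y₁ ⨯ N, t, prod.lift (𝟙 _) j, prod.lift (𝟙 _) 0,
      (mapCb E).map r₁ ≫ (mapCb E).map t ≫ y₂ + (mapCb E).map r₂ ≫ k,
      (isIso_Qb_map_iff t).2 ht, ?_, ?_, ?_⟩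
    · have hs : prod.lift (𝟙 Y₁) j = prod.lift (𝟙 Y₁) 0 + j ≫ prod.lift 0 (𝟙 N) := by
        apply Limits.prod.hom_ext
        · rw [Preadditive.add_comp, Category.assoc, prod.lift_fst, prod.lift_fst, prod.lift_fst,
            comp_zero, add_zero]
        · rw [Preadditive.add_comp, Category.assoc, prod.lift_snd, prod.lift_snd, prod.lift_snd,
            Category.comp_id, zero_add]
      rw [hs, Functor.map_add, Functor.map_comp, hj, zero_comp, add_zero]
    · rw [hl, hk, Preadditive.comp_sub]
      abel
    · rw [hl, Functor.map_zero, zero_comp, add_zero]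

/-- The dual comparison of `D^b(A)` with `D^b(B)`, for an exact functor `E : A ⥤ B` such that the
monomorphisms from objects in the image of `E` are dominated by monomorphisms of `A`. -/
noncomputable def fractionSquareOp (hE : RefinesMono E) :
    FractionSquare (mapCb E).op (Qb A).op (Qb B).op (mapDb E).op where
  iso := NatIso.op (mapDbFactors E).symm
  essSurj := inferInstance
  exists_fac {X Y} a := by
    obtain ⟨X', t, g, _, h⟩ := exists_Qb_left_fac a.unop
    exact ⟨op X', t.op, g.op, inferInstanceAs (IsIso ((Qb A).map t).op),
      Quiver.Hom.unop_inj h⟩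
  exists_fac' {X Z} φ := by
    obtain ⟨X', t, y, ht, h⟩ := hE.exists_left_fac X.unop Z.unop φ.unop.hom
    have := (isIso_Qb_map_iff t).2 ht
    refine ⟨op X', t.op, y.op, inferInstanceAs (IsIso ((Qb A).map t).op),
      Quiver.Hom.unop_inj ?_⟩
    ext
    exact h
  exists_eq {Y Z} y₁ y₂ h := by
    obtain ⟨Y₁, t, ht, ⟨h⟩⟩ := hE.exists_homotopy_of_Q_map_eq_zero (y₁.unop - y₂.unop) (by
      have h' := congrArg (·.unop.hom) h
      exact (DerivedCategory.Q.map_sub (f := y₁.unop.hom) (g := y₂.unop.hom)).trans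
        (sub_eq_zero.2 h'))
    obtain ⟨N, j, k, hj, hk⟩ := exists_fac_of_homotopy_zero' _ h
    -- After `t`, the morphisms `y₁` and `y₂` differ by a morphism that factors through the acyclic
    -- complex `N`. They factor through `Y₁ ⨿ N` by two morphisms to `Y₁` with the same image in
    -- `D^b(A)`.
    let r₁ : Y₁ ⟶ Y₁ ⨿ N := coprod.inl
    let r₂ : N ⟶ Y₁ ⨿ N := coprod.inr
    have hl (u : N ⟶ Y₁) :
        (y₂.unop ≫ (mapCb E).map t ≫ (mapCb E).map r₁ + k ≫ (mapCb E).map r₂) ≫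
          (mapCb E).map (coprod.desc (𝟙 Y₁) u) =
            y₂.unop ≫ (mapCb E).map t + k ≫ (mapCb E).map u := by
      simp only [Preadditive.add_comp, Category.assoc, ← Functor.map_comp, r₁, r₂,
        coprod.inl_desc, coprod.inr_desc, Category.comp_id]
    have hs : coprod.desc (𝟙 Y₁) j = coprod.desc (𝟙 Y₁) 0 + coprod.desc 0 (𝟙 N) ≫ j := by
      apply Limits.coprod.hom_ext
      · rw [Preadditive.comp_add, coprod.inl_desc_assoc, coprod.inl_desc, coprod.inl_desc,
          zero_comp, add_zero]
      · rw [Preadditive.comp_add, coprod.inr_desc_assoc, coprod.inr_desc, coprod.inr_desc,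
          Category.id_comp, zero_add]
    have hQ : (Qb A).map (coprod.desc (𝟙 Y₁) j) = (Qb A).map (coprod.desc (𝟙 Y₁) 0) := by
      rw [hs, Functor.map_add, Functor.map_comp, hj, comp_zero, add_zero]
    have h₁ := hl j
    have h₂ := hl 0
    rw [hk, Preadditive.sub_comp, add_sub_cancel] at h₁
    rw [Functor.map_zero, comp_zero, add_zero] at h₂
    have := (isIso_Qb_map_iff t).2 ht
    exact ⟨op Y₁, op (Y₁ ⨿ N), t.op, (coprod.desc (𝟙 _) j).op, (coprod.desc (𝟙 _) 0).op,
      (y₂.unop ≫ (mapCb E).map t ≫ (mapCb E).map r₁ + k ≫ (mapCb E).map r₂).op,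
      inferInstanceAs (IsIso ((Qb A).map t).op), congrArg Quiver.Hom.op hQ,
      congrArg Quiver.Hom.op h₁.symm, congrArg Quiver.Hom.op h₂.symm⟩

end

/-! ### Uniform bounds -/

section

variable {A : Type u₁} [Category.{v} A] [Abelian A] {B : Type u₂} [Category.{v} B] [Abelian B]

lemma eq_zero_of_map_disk (E : A ⥤ B) [E.Additive] {U : A} {i : ℤ} {Z : CochainComplex B ℤ}
    (hZ : IsZero (Z.X i)) (g : (E.mapHomologicalComplex (.up ℤ)).obj (disk U i) ⟶ Z) : g = 0 := by
  have : IsIso (((E.mapHomologicalComplex (.up ℤ)).obj (disk U i)).d i (i + 1)) := by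
    change IsIso (E.map ((disk U i).d i (i + 1)))
    rw [disk_d]
    infer_instance
  have h₀ : g.f i = 0 := hZ.eq_of_tgt _ _
  have h₁ : g.f (i + 1) = 0 := by
    have hg := g.comm i (i + 1)
    rw [← cancel_epi (((E.mapHomologicalComplex (.up ℤ)).obj (disk U i)).d i (i + 1)), ← hg, h₀,
      zero_comp, comp_zero]
  ext j
  by_cases hj₀ : j = i
  · subst hj₀
    exact h₀
  · by_cases hj₁ : j = i + 1
    · subst hj₁
      exact h₁
    · exact (E.map_isZero (HomologicalComplex.isZero_double_X _ _ _ hj₀ hj₁)).eq_of_src _ _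

lemma eq_zero_of_to_map_disk (E : A ⥤ B) [E.Additive] {U : A} {i : ℤ} {Z : CochainComplex B ℤ}
    (hZ : IsZero (Z.X (i + 1))) (g : Z ⟶ (E.mapHomologicalComplex (.up ℤ)).obj (disk U i)) :
    g = 0 := by
  have : IsIso (((E.mapHomologicalComplex (.up ℤ)).obj (disk U i)).d i (i + 1)) := by
    change IsIso (E.map ((disk U i).d i (i + 1)))
    rw [disk_d]
    infer_instance
  have h₁ : g.f (i + 1) = 0 := hZ.eq_of_src _ _
  have h₀ : g.f i = 0 := by
    have hg := g.comm i (i + 1)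
    rw [← cancel_mono (((E.mapHomologicalComplex (.up ℤ)).obj (disk U i)).d i (i + 1)), hg, h₁,
      zero_comp, comp_zero]
  ext j
  by_cases hj₀ : j = i
  · subst hj₀
    exact h₀
  · by_cases hj₁ : j = i + 1
    · subst hj₁
      exact h₁
    · exact (E.map_isZero (HomologicalComplex.isZero_double_X _ _ _ hj₀ hj₁)).eq_of_tgt _ _

/-- The degrees `i ∈ s` are removed one at a time: the quotient of `Y` by the image of the disk on
its object of degree `i` vanishes in degree `i`. -/
lemma exists_fac_of_isZero (E : A ⥤ B) [E.Additive] [PreservesFiniteColimits E]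
    {Y : CochainComplex A ℤ} {Z : CochainComplex B ℤ}
    (y : (E.mapHomologicalComplex (.up ℤ)).obj Y ⟶ Z) (s : Finset ℤ)
    (hs : ∀ i ∈ s, IsZero (Z.X i)) :
    ∃ (Y' : CochainComplex A ℤ) (t : Y ⟶ Y') (y' : (E.mapHomologicalComplex (.up ℤ)).obj Y' ⟶ Z),
      (E.mapHomologicalComplex (.up ℤ)).map t ≫ y' = y ∧ (∀ i ∈ s, IsZero (Y'.X i)) ∧
        ∀ i, IsZero (Y.X i) → IsZero (Y'.X i) := by
  classical
  induction s using Finset.induction_on generalizing Y with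
  | empty => exact ⟨Y, 𝟙 _, y, by simp, by simp, fun _ h => h⟩
  | insert i s hi ih =>
    let f : disk (Y.X i) i ⟶ Y := fromDisk (𝟙 _)
    have hπ (j : ℤ) : Epi ((cokernel.π f).f j) := inferInstance
    have hπ₀ : (cokernel.π f).f i = 0 := by
      have h : f.f i ≫ (cokernel.π f).f i = 0 := by
        rw [← HomologicalComplex.comp_f, cokernel.condition, HomologicalComplex.zero_f]
      simpa [f] using h
    let y₁ : (E.mapHomologicalComplex (.up ℤ)).obj (cokernel f) ⟶ Z :=
      (PreservesCokernel.iso (E.mapHomologicalComplex (.up ℤ)) f).hom ≫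
        cokernel.desc _ y (eq_zero_of_map_disk E (hs i (Finset.mem_insert_self _ _)) _)
    obtain ⟨Y', t, y', fac, h, h'⟩ := ih y₁ (fun j hj => hs j (Finset.mem_insert_of_mem hj))
    refine ⟨Y', cokernel.π f ≫ t, y', ?_, ?_, ?_⟩
    · rw [Functor.map_comp, Category.assoc, fac]
      simp [y₁]
    · intro j hj
      rcases Finset.mem_insert.1 hj with rfl | hj
      · exact h' _ (IsZero.of_epi_eq_zero _ hπ₀)
      · exact h j hj
    · exact fun j hj => h' j (hj.of_epi ((cokernel.π f).f j))

/-- The dual of `exists_fac_of_isZero`, with kernels of morphisms to disks. -/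
lemma exists_fac_of_isZero' (E : A ⥤ B) [E.Additive] [PreservesFiniteLimits E]
    {Y : CochainComplex A ℤ} {Z : CochainComplex B ℤ}
    (y : Z ⟶ (E.mapHomologicalComplex (.up ℤ)).obj Y) (s : Finset ℤ)
    (hs : ∀ i ∈ s, IsZero (Z.X i)) :
    ∃ (Y' : CochainComplex A ℤ) (t : Y' ⟶ Y) (y' : Z ⟶ (E.mapHomologicalComplex (.up ℤ)).obj Y'),
      y' ≫ (E.mapHomologicalComplex (.up ℤ)).map t = y ∧ (∀ i ∈ s, IsZero (Y'.X i)) ∧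
        ∀ i, IsZero (Y.X i) → IsZero (Y'.X i) := by
  classical
  induction s using Finset.induction_on generalizing Y with
  | empty => exact ⟨Y, 𝟙 _, y, by simp, by simp, fun _ h => h⟩
  | insert i s hi ih =>
    obtain ⟨i, rfl⟩ : ∃ j, i = j + 1 := ⟨i - 1, by simp⟩
    let f : Y ⟶ disk (Y.X (i + 1)) i := toDisk (𝟙 _)
    have hι (j : ℤ) : Mono ((kernel.ι f).f j) := inferInstance
    have hι₀ : (kernel.ι f).f (i + 1) = 0 := by
      have h : (kernel.ι f).f (i + 1) ≫ f.f (i + 1) = 0 := by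
        rw [← HomologicalComplex.comp_f, kernel.condition, HomologicalComplex.zero_f]
      simpa [f] using h
    let y₁ : Z ⟶ (E.mapHomologicalComplex (.up ℤ)).obj (kernel f) :=
      kernel.lift _ y (eq_zero_of_to_map_disk E (hs _ (Finset.mem_insert_self _ _)) _) ≫
        (PreservesKernel.iso (E.mapHomologicalComplex (.up ℤ)) f).inv
    obtain ⟨Y', t, y', fac, h, h'⟩ := ih y₁ (fun j hj => hs j (Finset.mem_insert_of_mem hj))
    refine ⟨Y', t ≫ kernel.ι f, y', ?_, ?_, ?_⟩
    · rw [Functor.map_comp, ← Category.assoc, fac]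
      simp [y₁]
    · intro j hj
      rcases Finset.mem_insert.1 hj with rfl | hj
      · exact h' _ (IsZero.of_mono_eq_zero _ hι₀)
      · exact h j hj
    · exact fun j hj => h' j (hj.of_mono ((kernel.ι f).f j))

end

section

variable {A : Type u₁} [Category.{v} A] [Abelian A]

lemma isStrictlyGE_and_isStrictlyLE_of_isZero {Y Y' : CochainComplex A ℤ} {a b c d : ℤ}
    (hGE : Y.IsStrictlyGE c) (hLE : Y.IsStrictlyLE d)
    (h : ∀ i ∈ Finset.Icc c d \ Finset.Icc a b, IsZero (Y'.X i))
    (h' : ∀ i, IsZero (Y.X i) → IsZero (Y'.X i)) : Y'.IsStrictlyGE a ∧ Y'.IsStrictlyLE b := by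
  have key (i : ℤ) (hi : i < a ∨ b < i) : IsZero (Y'.X i) := by
    rcases lt_or_ge i c with hc | hc
    · exact h' i (Y.isZero_of_isStrictlyGE c i)
    rcases lt_or_ge d i with hd | hd
    · exact h' i (Y.isZero_of_isStrictlyLE d i)
    refine h i ?_
    simp only [Finset.mem_sdiff, Finset.mem_Icc]
    lia
  rw [CochainComplex.isStrictlyGE_iff, CochainComplex.isStrictlyLE_iff]
  exact ⟨fun i hi => key i (.inl hi), fun i hi => key i (.inr hi)⟩

lemma cohomologyIn_Qb_obj [HasDerivedCategory.{w} A] (K : Cb A) (N : ℕ)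
    [K.obj.IsStrictlyGE (-N)] [K.obj.IsStrictlyLE N] : cohomologyIn A N ((Qb A).obj K) := by
  intro i hi
  refine IsZero.of_iso ?_ ((DerivedCategory.homologyFunctorFactors A i).app K.obj)
  refine ShortComplex.isZero_homology_of_isZero_X₂ _ (?_ : IsZero (K.obj.X i))
  rw [Set.mem_Icc, not_and_or, not_le, not_le] at hi
  rcases hi with hi | hi
  · exact K.obj.isZero_of_isStrictlyGE (-N) i hi
  · exact K.obj.isZero_of_isStrictlyLE N i hi

lemma exists_isStrictlyGE_isStrictlyLE (Z : Cb A) :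
    ∃ N : ℕ, Z.obj.IsStrictlyGE (-N) ∧ Z.obj.IsStrictlyLE N := by
  obtain ⟨a, b, _, _⟩ := Z.property
  exact ⟨a.natAbs + b.natAbs, Z.obj.isStrictlyGE_of_ge _ a (by lia),
    Z.obj.isStrictlyLE_of_le b _ (by lia)⟩

end

section

variable {A : Type u₁} [Category.{v} A] [Abelian A] {B : Type u₂} [Category.{v} B] [Abelian B]
  (E : A ⥤ B) [E.Additive]

/-- A morphism from `E(Y)` to a complex in degrees `-N, …, N` factors through `E(Y')` for a
complex `Y'` in the same degrees. -/
lemma exists_bounded_fac [PreservesFiniteColimits E] {Y : Cb A} {Z : Cb B}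
    (y : (mapCb E).obj Y ⟶ Z) (N : ℕ) (hGE : Z.obj.IsStrictlyGE (-N)) (hLE : Z.obj.IsStrictlyLE N) :
    ∃ (Y' : Cb A) (t : Y ⟶ Y') (y' : (mapCb E).obj Y' ⟶ Z),
      (Y'.obj.IsStrictlyGE (-N) ∧ Y'.obj.IsStrictlyLE N) ∧ (mapCb E).map t ≫ y' = y := by
  obtain ⟨c, d, _, _⟩ := Y.property
  obtain ⟨Y', t, y', fac, h, h'⟩ := exists_fac_of_isZero E y.hom
    (Finset.Icc c d \ Finset.Icc (-N : ℤ) N) (fun i hi => by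
      simp only [Finset.mem_sdiff, Finset.mem_Icc, not_and_or, not_le] at hi
      rcases hi.2 with hi | hi
      · exact Z.obj.isZero_of_isStrictlyGE (-N) i hi
      · exact Z.obj.isZero_of_isStrictlyLE N i hi)
  have hY' := isStrictlyGE_and_isStrictlyLE_of_isZero (Y := Y.obj) ‹_› ‹_› h h'
  refine ⟨⟨Y', _, _, hY'.1, hY'.2⟩, ⟨t⟩, ⟨y'⟩, hY', ?_⟩
  ext : 1
  exact fac

/-- A morphism to `E(Y)` from a complex in degrees `-N, …, N` factors through `E(Y')` for a
complex `Y'` in the same degrees. -/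
lemma exists_bounded_fac' [PreservesFiniteLimits E] {Y : Cb A} {Z : Cb B}
    (y : Z ⟶ (mapCb E).obj Y) (N : ℕ) (hGE : Z.obj.IsStrictlyGE (-N)) (hLE : Z.obj.IsStrictlyLE N) :
    ∃ (Y' : Cb A) (t : Y' ⟶ Y) (y' : Z ⟶ (mapCb E).obj Y'),
      (Y'.obj.IsStrictlyGE (-N) ∧ Y'.obj.IsStrictlyLE N) ∧ y' ≫ (mapCb E).map t = y := by
  obtain ⟨c, d, _, _⟩ := Y.property
  obtain ⟨Y', t, y', fac, h, h'⟩ := exists_fac_of_isZero' E y.hom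
    (Finset.Icc c d \ Finset.Icc (-N : ℤ) N) (fun i hi => by
      simp only [Finset.mem_sdiff, Finset.mem_Icc, not_and_or, not_le] at hi
      rcases hi.2 with hi | hi
      · exact Z.obj.isZero_of_isStrictlyGE (-N) i hi
      · exact Z.obj.isZero_of_isStrictlyLE N i hi)
  have hY' := isStrictlyGE_and_isStrictlyLE_of_isZero (Y := Y.obj) ‹_› ‹_› h h'
  refine ⟨⟨Y', _, _, hY'.1, hY'.2⟩, ⟨t⟩, ⟨y'⟩, hY', ?_⟩
  ext : 1
  exact fac

end

/-! ### Existence of the natural functors -/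

section

variable {A : Type u} [Category.{v} A] [Abelian A] [HasDerivedCategory.{v} A]

lemma uniformlyBoundedInd_indMap_indComplex (Z : Cb (Ind A)) :
    uniformlyBoundedInd A ((indMap (Qb A)).obj ((indComplex A).obj Z)) := by
  obtain ⟨N, hGE, hLE⟩ := exists_isStrictlyGE_isStrictlyLE Z
  obtain ⟨P, hP⟩ := exists_presentation_indMap_indAdjoint
    (isIndObject_mapCb _ isIndObject_indYoneda) (Qb A) Z (cohomologyIn A N) (fun Y y => by
      obtain ⟨Y', t, y', ⟨_, _⟩, fac⟩ := exists_bounded_fac _ y N hGE hLE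
      exact ⟨Y', t, y', cohomologyIn_Qb_obj Y' N, fac⟩)
  exact ⟨P, N, hP⟩

lemma uniformlyBoundedPro_proMap_proComplex (Z : Cb (Pro A)) :
    uniformlyBoundedPro A ((proMap (Qb A)).obj ((proComplex A).obj Z)) := by
  obtain ⟨N, hGE, hLE⟩ := exists_isStrictlyGE_isStrictlyLE Z
  obtain ⟨P, hP⟩ := exists_presentation_indMap_indAdjoint
    (isIndObject_mapCb_op _ isIndObject_proYoneda) (Qb A).op (op Z) (cohomologyIn A N).op
    (fun Y y => by
      obtain ⟨Y', t, y', ⟨_, _⟩, fac⟩ := exists_bounded_fac' _ y.unop N hGE hLE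
      exact ⟨op Y', t.op, y'.op, cohomologyIn_Qb_obj Y' N, congrArg Quiver.Hom.op fac⟩)
  exact ⟨P, N, hP⟩

instance : (uniformlyBoundedInd A).IsClosedUnderIsomorphisms where
  of_iso e := by
    rintro ⟨P, N, hP⟩
    exact ⟨P.extend ((Ind.inclusion _).map e.hom), N, hP⟩

instance : (uniformlyBoundedPro A).IsClosedUnderIsomorphisms where
  of_iso e := by
    rintro ⟨P, N, hP⟩
    exact ⟨P.extend ((Ind.inclusion _).map e.inv.unop), N, hP⟩

variable (A) in
lemma exists_isNaturalInd [HasDerivedCategory.{w} (Ind A)] :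
    ∃ J : DerivedCategory.Bounded (Ind A) ⥤ IndDb A, IsNaturalInd J := by
  obtain ⟨J, ⟨e⟩⟩ := (fractionSquare (refinesEpi_indYoneda (A := A))).exists_functor
    (isIndObject_mapCb _ isIndObject_indYoneda)
  refine ⟨ObjectProperty.lift _ J (fun X => ?_), ⟨e⟩⟩
  exact ObjectProperty.prop_of_iso _
    ((e.app ((Qb (Ind A)).objPreimage X)).symm ≪≫
      J.mapIso ((Qb (Ind A)).objObjPreimageIso X)) (uniformlyBoundedInd_indMap_indComplex _)

variable (A) in
lemma exists_isNaturalPro [HasDerivedCategory.{w} (Pro A)] :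
    ∃ J : DerivedCategory.Bounded (Pro A) ⥤ ProDb A, IsNaturalPro J := by
  obtain ⟨J, ⟨e⟩⟩ := (fractionSquareOp (refinesMono_proYoneda (A := A))).exists_functor
    (isIndObject_mapCb_op _ isIndObject_proYoneda)
  let e' : Qb (Pro A) ⋙ J.rightOp ≅ proComplex A ⋙ proMap (Qb A) :=
    NatIso.ofComponents (fun Z => (e.app (op Z)).op.symm) (fun {Z Z'} f => by
      exact congrArg Quiver.Hom.op (e.inv.naturality f.op).symm)
  refine ⟨ObjectProperty.lift _ J.rightOp (fun X => ?_), ⟨e'⟩⟩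
  exact ObjectProperty.prop_of_iso _
    ((e'.app ((Qb (Pro A)).objPreimage X)).symm ≪≫
      J.rightOp.mapIso ((Qb (Pro A)).objObjPreimageIso X)) (uniformlyBoundedPro_proMap_proComplex _)

end

/-! ### Detecting quasi-isomorphisms by maps from and to objects in one degree -/

section

open Pretriangulated HomologicalComplex

variable {B : Type u} [Category.{v} B] [Abelian B] [HasDerivedCategory.{w} B]

lemma homologyMap_eq_zero_of_Q_map_eq_zero {K L : CochainComplex B ℤ} (f : K ⟶ L)
    (hf : DerivedCategory.Q.map f = 0) (n : ℤ) : homologyMap f n = 0 := by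
  have h := (DerivedCategory.homologyFunctorFactors B n).hom.naturality f
  refine (cancel_epi ((DerivedCategory.homologyFunctorFactors B n).hom.app K)).1
    (h.symm.trans ?_)
  have h' : (DerivedCategory.Q ⋙ DerivedCategory.homologyFunctor B n).map f = 0 :=
    (congrArg (DerivedCategory.homologyFunctor B n).map hf).trans
      (Functor.map_zero _ _ _)
  rw [h', zero_comp]
  exact comp_zero.symm

/-- A morphism `M ⟶ C.cycles n` is a morphism of complexes from `M` in degree `n` to `C`. If it
vanishes in the derived category, it vanishes in homology. -/
lemma comp_homologyπ_eq_zero {C : CochainComplex B ℤ} {n : ℤ} {M : B}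
    (hM : ∀ φ : (DerivedCategory.singleFunctor B n).obj M ⟶ DerivedCategory.Q.obj C, φ = 0)
    (x : M ⟶ C.cycles n) : x ≫ C.homologyπ n = 0 := by
  let f : (single B (.up ℤ) n).obj M ⟶ C :=
    mkHomFromSingle (x ≫ C.iCycles n) (fun k _ => by simp)
  have hf := homologyMap_eq_zero_of_Q_map_eq_zero f (hM _) n
  have hx : (singleObjCyclesSelfIso (.up ℤ) n M).inv ≫ cyclesMap f n = x := by
    rw [← cancel_mono (C.iCycles n), Category.assoc, cyclesMap_i,
      singleObjCyclesSelfIso_inv_iCycles_assoc]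
    simp [f]
  rw [← hx, Category.assoc, ← homologyπ_naturality, hf, comp_zero, comp_zero]

/-- The dual of `comp_homologyπ_eq_zero`. -/
lemma homologyι_comp_eq_zero {C : CochainComplex B ℤ} {n : ℤ} {M : B}
    (hM : ∀ φ : DerivedCategory.Q.obj C ⟶ (DerivedCategory.singleFunctor B n).obj M, φ = 0)
    (x : C.opcycles n ⟶ M) : C.homologyι n ≫ x = 0 := by
  let f : C ⟶ (single B (.up ℤ) n).obj M :=
    mkHomToSingle (C.pOpcycles n ≫ x) (fun k _ => by simp)
  have hf := homologyMap_eq_zero_of_Q_map_eq_zero f (hM _) n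
  have hx : opcyclesMap f n ≫ (singleObjOpcyclesSelfIso (.up ℤ) n M).inv = x := by
    rw [← cancel_epi (C.pOpcycles n), p_opcyclesMap_assoc,
      pOpcycles_singleObjOpcyclesSelfIso_inv]
    simp [f]
  rw [← hx, ← homologyι_naturality_assoc, hf, zero_comp]

lemma isIso_Q_map_of_isZero_homology_mappingCone {K L : CochainComplex B ℤ} (g : K ⟶ L)
    (h : ∀ n, IsZero ((CochainComplex.mappingCone g).homology n)) :
    IsIso (DerivedCategory.Q.map g) :=
  (Triangle.isZero₃_iff_isIso₁ _ (DerivedCategory.mappingCone_triangle_distinguished g)).1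
    ((isZero_Q_obj_iff _).2 (fun n => (exactAt_iff_isZero_homology _ n).2 (h n)))

variable {T : Triangle (DerivedCategory B)}

/-- If composition with `T.mor₁` is bijective on the morphisms from `M` in any degree, the long
exact sequence shows that there are no nonzero morphisms from `M` in any degree to `T.obj₃`. -/
lemma eq_zero_of_bijective_comp_mor₁ (hT : T ∈ distTriang _) {M : B}
    (hM : ∀ n, Function.Bijective
      (fun f : (DerivedCategory.singleFunctor B n).obj M ⟶ T.obj₁ => f ≫ T.mor₁))
    {n : ℤ} (φ : (DerivedCategory.singleFunctor B n).obj M ⟶ T.obj₃) : φ = 0 := by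
  let e := ((DerivedCategory.singleFunctors B).shiftIso 1 n (n + 1) (add_comm _ _)).app M
  obtain ⟨ψ, hψ⟩ := (shiftFunctor (DerivedCategory B) (1 : ℤ)).map_surjective
    (e.hom ≫ φ ≫ T.mor₃)
  have hψ₀ : ψ = 0 := by
    refine (hM (n + 1)).1 ((shiftFunctor (DerivedCategory B) (1 : ℤ)).map_injective ?_)
    dsimp only
    rw [zero_comp, Functor.map_comp, hψ, Category.assoc, Category.assoc,
      comp_distTriang_mor_zero₃₁ _ hT, comp_zero, comp_zero, Functor.map_zero]
  have hφ : φ ≫ T.mor₃ = 0 := by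
    rw [hψ₀, Functor.map_zero] at hψ
    rw [← cancel_epi e.hom, ← hψ, comp_zero]
  obtain ⟨χ, rfl⟩ := T.coyoneda_exact₃ hT φ hφ
  obtain ⟨χ', rfl⟩ := (hM n).2 χ
  dsimp only
  rw [Category.assoc, comp_distTriang_mor_zero₁₂ _ hT, comp_zero]

/-- The dual of `eq_zero_of_bijective_comp_mor₁`. -/
lemma eq_zero_of_bijective_mor₁_comp (hT : T ∈ distTriang _) {M : B}
    (hM : ∀ n, Function.Bijective
      (fun f : T.obj₂ ⟶ (DerivedCategory.singleFunctor B n).obj M => T.mor₁ ≫ f))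
    {n : ℤ} (φ : T.obj₃ ⟶ (DerivedCategory.singleFunctor B n).obj M) : φ = 0 := by
  let e := ((DerivedCategory.singleFunctors B).shiftIso 1 n (n + 1) (add_comm _ _)).app M
  have hφ : T.mor₂ ≫ φ = 0 := by
    refine (hM n).1 ?_
    dsimp only
    rw [comp_distTriang_mor_zero₁₂_assoc _ hT, zero_comp, comp_zero]
  obtain ⟨ψ, rfl⟩ := T.yoneda_exact₃ hT φ hφ
  obtain ⟨ψ', hψ'⟩ := (shiftFunctor (DerivedCategory B) (1 : ℤ)).map_surjective (ψ ≫ e.inv)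
  obtain ⟨χ, rfl⟩ := (hM (n + 1)).2 ψ'
  dsimp only at hψ'
  rw [← cancel_mono e.inv, Category.assoc, ← hψ', Functor.map_comp, zero_comp,
    ← Category.assoc, comp_distTriang_mor_zero₃₁ _ hT, zero_comp]

end

section

variable {A : Type u₁} [Category.{v} A] [Abelian A] {B : Type u₂} [Category.{v} B] [Abelian B]
  [HasDerivedCategory.{v} A] [HasDerivedCategory.{w} B]
  (E : A ⥤ B) [E.Additive] [PreservesFiniteLimits E] [PreservesFiniteColimits E]

/-- The object `U` of `A` in degree `n`, as an object of `D^b(A)`. -/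
noncomputable def singleDb (U : A) (n : ℤ) : DerivedCategory.Bounded A :=
  (Qb A).obj ⟨(HomologicalComplex.single A (.up ℤ) n).obj U, n, n, inferInstance, inferInstance⟩

/-- `E` carries the object `U` in degree `n` to the object `E(U)` in degree `n`. -/
noncomputable def mapDbSingleIso (U : A) (n : ℤ) :
    ((mapDb E).obj (singleDb U n)).obj ≅ (DerivedCategory.singleFunctor B n).obj (E.obj U) :=
  (E.mapDerivedCategorySingleFunctor n).app U

/-- If the image of `E` generates `B`, the isomorphisms of `D^b(B)` are detected by the morphisms
from objects of `D^b(A)`. -/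
lemma isIso_Qb_map_of_bijective_comp
    (hE : ∀ (M N : B) (f : M ⟶ N), (∀ U (x : E.obj U ⟶ M), x ≫ f = 0) → f = 0)
    {Z Z' : Cb B} (g : Z ⟶ Z')
    (hg : ∀ X, Function.Bijective
      (fun f : (mapDb E).obj X ⟶ (Qb B).obj Z => f ≫ (Qb B).map g)) :
    IsIso ((Qb B).map g) := by
  have h₁ : ∀ U n, Function.Bijective
      (fun f : (DerivedCategory.singleFunctor B n).obj (E.obj U) ⟶ DerivedCategory.Q.obj Z.obj =>
        f ≫ DerivedCategory.Q.map g.hom) := fun U n => by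
    let e := mapDbSingleIso E U n
    refine ⟨fun f f' h => ?_, fun f => ?_⟩
    · have h' : (⟨e.hom ≫ f⟩ : (mapDb E).obj (singleDb U n) ⟶ (Qb B).obj Z) = ⟨e.hom ≫ f'⟩ :=
        (hg _).1 (ObjectProperty.hom_ext _ (by
          exact (Category.assoc _ _ _).trans
            ((congrArg (e.hom ≫ ·) h).trans (Category.assoc _ _ _).symm)))
      exact (cancel_epi e.hom).1 (congrArg (fun k => k.hom) h')
    · obtain ⟨φ, hφ⟩ := (hg (singleDb U n)).2 ⟨e.hom ≫ f⟩
      let φ' : ((mapDb E).obj (singleDb U n)).obj ⟶ DerivedCategory.Q.obj Z.obj := φ.hom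
      refine ⟨e.inv ≫ φ', (cancel_epi e.hom).1 ?_⟩
      have h' : φ' ≫ DerivedCategory.Q.map g.hom = e.hom ≫ f :=
        congrArg (fun k => k.hom) hφ
      dsimp only
      rw [Category.assoc, h', e.inv_hom_id_assoc]
  rw [isIso_Qb_map_iff, ← DerivedCategory.isIso_Q_map_iff_quasiIso]
  refine isIso_Q_map_of_isZero_homology_mappingCone g.hom (fun n => ?_)
  rw [IsZero.iff_id_eq_zero, ← cancel_epi (HomologicalComplex.homologyπ _ n), comp_zero,
    Category.comp_id]
  exact hE _ _ _ (fun U => comp_homologyπ_eq_zero (eq_zero_of_bijective_comp_mor₁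
    (DerivedCategory.mappingCone_triangle_distinguished g.hom) (h₁ U)))

/-- If the image of `E` cogenerates `B`, the isomorphisms of `D^b(B)` are detected by the morphisms
to objects of `D^b(A)`. -/
lemma isIso_Qb_map_of_bijective_comp'
    (hE : ∀ (M N : B) (f : M ⟶ N), (∀ U (x : N ⟶ E.obj U), f ≫ x = 0) → f = 0)
    {Z Z' : Cb B} (g : Z ⟶ Z')
    (hg : ∀ X, Function.Bijective
      (fun f : (Qb B).obj Z' ⟶ (mapDb E).obj X => (Qb B).map g ≫ f)) :
    IsIso ((Qb B).map g) := by
  have h₁ : ∀ U n, Function.Bijective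
      (fun f : DerivedCategory.Q.obj Z'.obj ⟶ (DerivedCategory.singleFunctor B n).obj (E.obj U) =>
        DerivedCategory.Q.map g.hom ≫ f) := fun U n => by
    let e := mapDbSingleIso E U n
    refine ⟨fun f f' h => ?_, fun f => ?_⟩
    · have h' : (⟨f ≫ e.inv⟩ : (Qb B).obj Z' ⟶ (mapDb E).obj (singleDb U n)) = ⟨f' ≫ e.inv⟩ :=
        (hg _).1 (ObjectProperty.hom_ext _ (by
          exact (Category.assoc _ _ _).symm.trans
            ((congrArg (· ≫ e.inv) h).trans (Category.assoc _ _ _))))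
      exact (cancel_mono e.inv).1 (congrArg (fun k => k.hom) h')
    · obtain ⟨φ, hφ⟩ := (hg (singleDb U n)).2 ⟨f ≫ e.inv⟩
      let φ' : DerivedCategory.Q.obj Z'.obj ⟶ ((mapDb E).obj (singleDb U n)).obj := φ.hom
      refine ⟨φ' ≫ e.hom, (cancel_mono e.inv).1 ?_⟩
      have h' : DerivedCategory.Q.map g.hom ≫ φ' = f ≫ e.inv :=
        congrArg (fun k => k.hom) hφ
      dsimp only
      rw [← h', Category.assoc, Category.assoc, e.hom_inv_id, Category.comp_id]
  rw [isIso_Qb_map_iff, ← DerivedCategory.isIso_Q_map_iff_quasiIso]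
  refine isIso_Q_map_of_isZero_homology_mappingCone g.hom (fun n => ?_)
  rw [IsZero.iff_id_eq_zero, ← cancel_mono (HomologicalComplex.homologyι _ n), zero_comp,
    Category.id_comp]
  exact hE _ _ _ (fun U => homologyι_comp_eq_zero (eq_zero_of_bijective_mor₁_comp
    (DerivedCategory.mappingCone_triangle_distinguished g.hom) (h₁ U)))

end

/-! ### Conservativity -/

section

variable {B : Type u₁} [Category.{v} B] [Abelian B] [HasDerivedCategory.{w} B]

/-- It suffices to consider morphisms of complexes, because every morphism of `D^b(B)` is isomorphic
to the image of one. -/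
lemma reflectsIsomorphisms_of_Qb {D : Type*} [Category* D] (F : DerivedCategory.Bounded B ⥤ D)
    (hF : ∀ {Z Z' : Cb B} (g : Z ⟶ Z'), IsIso (F.map ((Qb B).map g)) → IsIso ((Qb B).map g)) :
    F.ReflectsIsomorphisms where
  reflects {X Y} f _ := by
    let eX := (Qb B).objObjPreimageIso X
    let eY := (Qb B).objObjPreimageIso Y
    obtain ⟨Z, t, g, _, h⟩ := exists_Qb_right_fac (eX.hom ≫ f ≫ eY.inv)
    have h' : f = eX.inv ≫ inv ((Qb B).map t) ≫ (Qb B).map g ≫ eY.hom := by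
      rw [← h]
      simp
    have : IsIso ((Qb B).map g) := hF g (by
      rw [← h]
      simp only [Functor.map_comp]
      infer_instance)
    rw [h']
    infer_instance

end

section

variable {A : Type u} [Category.{v} A] [Abelian A] [HasDerivedCategory.{v} A]

lemma IsNaturalInd.reflectsIsomorphisms [HasDerivedCategory.{w} (Ind A)]
    {J : DerivedCategory.Bounded (Ind A) ⥤ IndDb A} (hJ : IsNaturalInd J) :
    J.ReflectsIsomorphisms := by
  obtain ⟨e⟩ := hJ
  refine reflectsIsomorphisms_of_Qb J (fun {Z Z'} g hg => ?_)
  have hg' : IsIso ((indComplex A ⋙ indMap (Qb A)).map g) := by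
    rw [← NatIso.isIso_map_iff e g]
    exact inferInstanceAs (IsIso ((uniformlyBoundedInd A).ι.map (J.map ((Qb (Ind A)).map g))))
  exact isIso_Qb_map_of_bijective_comp Ind.yoneda (fun _ _ => eq_zero_of_indYoneda_comp) g
    ((fractionSquare (refinesEpi_indYoneda (A := A))).bijective_of_isIso
      (isIndObject_mapCb _ isIndObject_indYoneda) g hg')

lemma IsNaturalPro.reflectsIsomorphisms [HasDerivedCategory.{w} (Pro A)]
    {J : DerivedCategory.Bounded (Pro A) ⥤ ProDb A} (hJ : IsNaturalPro J) :
    J.ReflectsIsomorphisms := by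
  obtain ⟨e⟩ := hJ
  refine reflectsIsomorphisms_of_Qb J (fun {Z Z'} g hg => ?_)
  have hg' : IsIso ((proComplex A ⋙ proMap (Qb A)).map g) := by
    rw [← NatIso.isIso_map_iff e g]
    exact inferInstanceAs (IsIso ((uniformlyBoundedPro A).ι.map (J.map ((Qb (Pro A)).map g))))
  have hb := (fractionSquareOp (refinesMono_proYoneda (A := A))).bijective_of_isIso
    (isIndObject_mapCb_op _ isIndObject_proYoneda) g.op
      (inferInstanceAs (IsIso ((proComplex A ⋙ proMap (Qb A)).map g).unop))
  refine isIso_Qb_map_of_bijective_comp' proYoneda (fun _ _ => eq_zero_of_comp_proYoneda) g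
    (fun X => ⟨fun f f' h => ?_, fun f => ?_⟩)
  · exact Quiver.Hom.op_inj ((hb (op X)).1 (congrArg Quiver.Hom.op h))
  · obtain ⟨φ, hφ⟩ := (hb (op X)).2 f.op
    exact ⟨φ.unop, congrArg Quiver.Hom.unop hφ⟩

end

end IndPro

theorem mainTheorem12 {A : Type u} [Category.{v} A] [Abelian A]
    [HasDerivedCategory.{v} A] [HasDerivedCategory.{w₁} (Ind A)]
    [HasDerivedCategory.{w₂} (IndPro.Pro A)] :
    ((∃ J : DerivedCategory.Bounded (Ind A) ⥤ IndPro.IndDb A, IndPro.IsNaturalInd J) ∧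
      ∀ J : DerivedCategory.Bounded (Ind A) ⥤ IndPro.IndDb A, IndPro.IsNaturalInd J →
        J.ReflectsIsomorphisms) ∧
    ((∃ J : DerivedCategory.Bounded (IndPro.Pro A) ⥤ IndPro.ProDb A, IndPro.IsNaturalPro J) ∧
      ∀ J : DerivedCategory.Bounded (IndPro.Pro A) ⥤ IndPro.ProDb A, IndPro.IsNaturalPro J →
        J.ReflectsIsomorphisms) := by
  exact ⟨⟨IndPro.exists_isNaturalInd A, fun _ hJ => hJ.reflectsIsomorphisms⟩,
    ⟨IndPro.exists_isNaturalPro A, fun _ hJ => hJ.reflectsIsomorphisms⟩⟩
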